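/- **(Sample complexity of $Q$-NPG)** Let $M$ be a discounted MDP with state space $\mathcal S$ (finite, or more generally arbitrary with discrete transition laws), finite nonempty action space $\mathcal A$, transition probabilities $P(\cdot\mid s,a)$, rewards $r(s,a)\in[0,1]$ and discount factor $\gamma\in[0,1)$. For a policy $\pi$ let $V^\pi(s)$ and $Q^\pi(s,a)$ be the expected $\gamma$-discounted sums of rewards and $V^\pi(\rho)=\mathbb E_{s\sim\rho}V^\pi(s)$; let $d^\pi_\rho(s)=(1-\gamma)\,\mathbb E_{s_0\sim\rho}\sum_{t\ge0}\gamma^t\Pr^\pi(s_t=s\mid s_0)$ and $d^\pi_\nu(s,a)=(1-\gamma)\,\mathbb E_{(s_0,a_0)\sim\nu}\sum_{t\ge0}\gamma^t\Pr^\pi(s_t=s,a_t=a\mid s_0,a_0)$. Let $\phi_{s,a}\in\mathbb R^d$ be features with $\|\phi_{s,a}\|_2\le B$ for all $s,a$, and let $\pi_\theta(a\mid s)\propto\exp(\theta\cdot\phi_{s,a})$, $\theta\in\mathbb R^d$, be the log-linear policies. For a state-action distribution $\upsilon$ put $$L(w;\theta,\upsilon)=\mathbb E_{(s,a)\sim\upsilon}\big[(Q^{\pi_\theta}(s,a)-w\cdot\phi_{s,a})^2\big],\qquad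 \Sigma_\upsilon=\mathbb E_{(s,a)\sim\upsilon}[\phi_{s,a}\phi_{s,a}^\top].$$ Fix a state distribution $\rho$, a state-action distribution $\nu$, an arbitrary comparator policy $\pi^\star$, constants $B,W>0$ and integers $T,N\ge1$. Let $d^\star(s,a)=d_\rho^{\pi^\star}(s)/|\mathcal A|$, and suppose that $$\kappa=\sup_{w\in\mathbb R^d}\frac{w^\top\Sigma_{d^\star}w}{w^\top\Sigma_\nu w}<\infty$$ (with $0/0=0$ and $c/0=\infty$ for $c>0$). *Sampler (for $\nu$ and $\pi$, using the episodic oracle).* Draw $(s_0,a_0)\sim\nu$. At every time step $h\ge 0$, with probability $\gamma$ execute $a_h$ and continue with $\pi$; otherwise accept $(s_h,a_h)$. Then execute $a_h$ and continue to execute $\pi$, terminating with probability $1-\gamma$ after each executed action. Return $(s_h,a_h)$ and $\widehat Q$, the undiscounted sum of the rewards from time $h$ on. The number of samples of the episode is one for the starting pair plus one for every executed action. *Sample-based $Q$-NPG.* Set $\theta^{(0)}=0$. For $t=0,\dots,T-1$: set $w_0=0$; for $n=0,\dots,N-1$ call the sampler afresh with $\pi=\pi_{\theta^{(t)}}$ to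 obtain $(s,a)$ and $\widehat Q$, and put $w_{n+1}=\mathrm{Proj}_{\{\|w\|_2\le W\}}\big(w_n-2\alpha(w_n\cdot\phi_{s,a}-\widehat Q)\phi_{s,a}\big)$; then $\theta^{(t+1)}=\theta^{(t)}+\eta\,\frac1N\sum_{n=1}^N w_n$. Use the learning rates $$\eta=\sqrt{\frac{2\log|\mathcal A|}{B^2W^2T}},\qquad \alpha=\frac{W}{2B\big(BW+\frac1{1-\gamma}\big)\sqrt N}.$$ Let $w_\star^{(t)}\in\arg\min_{\|w\|_2\le W}L(w;\theta^{(t)},d_\nu^{\pi_{\theta^{(t)}}})$ be minimizers (selected as a function of $t$ and $\theta^{(t)}$) and suppose that $\mathbb E\big[L(w_\star^{(t)};\theta^{(t)},d^\star)\big]\le\varepsilon_{\mathrm{bias}}$ for all $t<T$, the expectation being over the run of the algorithm. Then $$\mathbb E\Big[\min_{t<T}\big\{V^{\pi^\star}(\rho)-V^{\pi_{\theta^{(t)}}}(\rho)\big\}\Big]\le\frac{BW}{1-\gamma}\sqrt{\frac{2\log|\mathcal A|}{T}}+\sqrt{\frac{8\kappa|\mathcal A|BW(BW+1)}{(1-\gamma)^4}}\;\frac1{N^{1/4}}+\frac{\sqrt{4|\mathcal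 A|\varepsilon_{\mathrm{bias}}}}{1-\gamma},$$ and the expected total number of samples used by the algorithm is exactly $2NT/(1-\gamma)$. -/

import Mathlib

open scoped ENNReal NNReal

namespace QNPG

universe u v w

noncomputable section

/-- The expectation `E_{x ∼ p} f(x)` of a real function under a discrete law. -/
def expect {α : Type u} (p : PMF α) (f : α → ℝ) : ℝ := ∑' x, (p x).toReal * f x

/-- The `n`-step law of the Markov chain with one-step law `step`, started at a point. -/
def iter {α : Type u} (step : α → PMF α) : ℕ → α → PMF α
  | 0, x => PMF.pure x
  | n + 1, x => (step x).bind (iter step n)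

/-- The number of consecutive successes (each of probability `γ`) before the first failure. -/
def geom (γ : ℝ) (h0 : 0 ≤ γ) (h1 : γ < 1) : PMF ℕ :=
  ⟨fun n => ENNReal.ofReal ((1 - γ) * γ ^ n), by
    have hs : HasSum (fun n : ℕ => (1 - γ) * γ ^ n) 1 := by
      have h := (hasSum_geometric_of_lt_one h0 h1).mul_left (1 - γ)
      rwa [mul_inv_cancel₀ (by linarith : (1 - γ) ≠ 0)] at h
    have hn : ∀ n : ℕ, 0 ≤ (1 - γ) * γ ^ n := fun n =>
      mul_nonneg (by linarith) (pow_nonneg h0 n)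
    have h2 := ENNReal.ofReal_tsum_of_nonneg hn hs.summable
    rw [hs.tsum_eq, ENNReal.ofReal_one] at h2
    rw [h2]
    exact ENNReal.summable.hasSum⟩

/-- The randomly stopped loop: before every step, with probability `γ` take one more step of the
chain; otherwise stop and return the current configuration. -/
def loop {α : Type u} (γ : ℝ) (h0 : 0 ≤ γ) (h1 : γ < 1) (step : α → PMF α) (x : α) : PMF α :=
  (geom γ h0 h1).bind fun n => iter step n x

/-- The loop does what its description says: with probability `1 - γ` it stops at once, and with
probability `γ` it takes a step and starts afresh from there. -/
theorem loop_apply {α : Type u} (γ : ℝ) (h0 : 0 ≤ γ) (h1 : γ < 1) (step : α → PMF α) (x y : α) :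
    loop γ h0 h1 step x y =
      ENNReal.ofReal (1 - γ) * PMF.pure x y +
        ENNReal.ofReal γ * ((step x).bind (loop γ h0 h1 step)) y := by
  have hg : ∀ n, geom γ h0 h1 (n + 1) = ENNReal.ofReal γ * geom γ h0 h1 n := by
    intro n
    change ENNReal.ofReal ((1 - γ) * γ ^ (n + 1)) = _ * ENNReal.ofReal ((1 - γ) * γ ^ n)
    rw [← ENNReal.ofReal_mul h0]
    congr 1
    ring
  have hz : geom γ h0 h1 0 = ENNReal.ofReal (1 - γ) := by
    change ENNReal.ofReal ((1 - γ) * γ ^ 0) = _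
    simp
  have h2 : (step x).bind (loop γ h0 h1 step) =
      (geom γ h0 h1).bind fun n => (step x).bind (iter step n) := by
    unfold loop
    exact PMF.bind_comm _ _ _
  rw [h2]
  unfold loop
  rw [PMF.bind_apply, PMF.bind_apply, tsum_eq_zero_add' ENNReal.summable, hz,
    ← ENNReal.tsum_mul_left]
  congr 1
  refine tsum_congr fun n => ?_
  rw [hg, mul_assoc]
  rfl

/-- A discounted Markov decision process with states `S`, actions `A`, transition probabilities
`P`, rewards in `[0,1]` and discount factor `γ ∈ [0,1)`. -/
structure MDP (S : Type u) (A : Type v) where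
  P : S → A → PMF S
  r : S → A → ℝ
  r_nonneg : ∀ s a, 0 ≤ r s a
  r_le_one : ∀ s a, r s a ≤ 1
  γ : ℝ
  γ_nonneg : 0 ≤ γ
  γ_lt_one : γ < 1

section Dynamics

variable {S : Type u} {A : Type v} (M : MDP S A) (π : S → PMF A)

/-- The law of the next state-action pair under the policy `π`: first `s' ∼ P(· | s, a)`, then
`a' ∼ π(· | s')`. -/
def MDP.next (x : S × A) : PMF (S × A) :=
  (M.P x.1 x.2).bind fun s' => (π s').map fun a' => (s', a')

/-- The law of `(s_t, a_t)` given `(s_0, a_0)`, following `π` from time `1` on. -/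
def MDP.lawFrom (x₀ : S × A) (t : ℕ) : PMF (S × A) := iter (M.next π) t x₀

/-- The law of `(s_t, a_t)` given `s_0`, following `π` from time `0` on. -/
def MDP.law (s₀ : S) (t : ℕ) : PMF (S × A) := (π s₀).bind fun a₀ => M.lawFrom π (s₀, a₀) t

/-- `V^π(s)`. -/
def MDP.V (s : S) : ℝ := ∑' t : ℕ, M.γ ^ t * expect (M.law π s t) fun x => M.r x.1 x.2

/-- `V^π(ρ)`. -/
def MDP.value (ρ : PMF S) : ℝ := expect ρ (M.V π)

/-- `Q^π(s, a)`. -/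
def MDP.Q (x : S × A) : ℝ := ∑' t : ℕ, M.γ ^ t * expect (M.lawFrom π x t) fun y => M.r y.1 y.2

/-- The discounted state visitation distribution `d_ρ^π`. -/
def MDP.stateVisit (ρ : PMF S) (s : S) : ℝ :=
  expect ρ fun s₀ => (1 - M.γ) * ∑' t : ℕ, M.γ ^ t * ((M.law π s₀ t).map Prod.fst s).toReal

/-- The discounted state-action visitation distribution `d_ν^π`. -/
def MDP.visit (ν : PMF (S × A)) (x : S × A) : ℝ :=
  (1 - M.γ) * expect ν fun x₀ => ∑' t : ℕ, M.γ ^ t * (M.lawFrom π x₀ t x).toReal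

/-- The comparator measure `d^⋆(s, a) = d_ρ^π(s) · Unif_A(a)`. -/
def MDP.dStar [Fintype A] (ρ : PMF S) (x : S × A) : ℝ :=
  M.stateVisit π ρ x.1 * (1 / (Fintype.card A : ℝ))

/-- One call of the sampler with starting distribution `ν` and policy `π`; it returns
`((s_h, a_h), Q̂, k)`, where `k` is the number of samples drawn from the episodic oracle: one for the
starting pair and one for every executed action.

Draw `(s_0, a_0) ∼ ν`. At every time step, with probability `γ` execute the current action and
continue with `π`; otherwise accept the current pair `(s_h, a_h)`. Then execute `a_h`, and continue
to execute `π` with termination probability `1 - γ` after every executed action; `Q̂` is the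
undiscounted sum of the rewards from time `h` on. -/
def MDP.sampler (ν : PMF (S × A)) : PMF ((S × A) × ℝ × ℕ) :=
  ν.bind fun x₀ =>
    (loop M.γ M.γ_nonneg M.γ_lt_one
      (fun c : (S × A) × ℕ => (M.next π c.1).map fun y => (y, c.2 + 1)) (x₀, 1)).bind fun c =>
    (loop M.γ M.γ_nonneg M.γ_lt_one
      (fun e : (S × A) × ℝ × ℕ =>
        (M.next π e.1).map fun y => (y, e.2.1 + M.r y.1 y.2, e.2.2 + 1))
      (c.1, M.r c.1.1 c.1.2, c.2 + 1)).map fun e => (c.1, e.2.1, e.2.2)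

end Dynamics

section Features

variable {S : Type u} {A : Type v} {d : ℕ} (φ : S → A → EuclideanSpace ℝ (Fin d))

/-- The log-linear policy `π_θ(a | s) = exp(θ · φ_{s,a}) / ∑_{a'} exp(θ · φ_{s,a'})`. -/
def logLinear [Fintype A] [Nonempty A] (θ : EuclideanSpace ℝ (Fin d)) (s : S) : PMF A :=
  PMF.ofFintype
    (fun a => ENNReal.ofReal
      (Real.exp (inner ℝ θ (φ s a)) / ∑ a', Real.exp (inner ℝ θ (φ s a')))) (by
    have hpos : 0 < ∑ a', Real.exp (inner ℝ θ (φ s a')) :=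
      Finset.sum_pos (fun _ _ => Real.exp_pos _) Finset.univ_nonempty
    rw [← ENNReal.ofReal_sum_of_nonneg fun a _ => div_nonneg (Real.exp_pos _).le hpos.le,
      ← Finset.sum_div, div_self hpos.ne', ENNReal.ofReal_one])

/-- The regression loss `L(w; θ, υ) = E_{(s,a) ∼ υ} (Q^{π_θ}(s,a) - w · φ_{s,a})²`. -/
def loss [Fintype A] [Nonempty A] (M : MDP S A) (w θ : EuclideanSpace ℝ (Fin d))
    (υ : S × A → ℝ) : ℝ :=
  ∑' x : S × A, υ x * (M.Q (logLinear φ θ) x - inner ℝ w (φ x.1 x.2)) ^ 2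

/-- The feature covariance matrix `Σ_υ = E_{(s,a) ∼ υ} φ_{s,a} φ_{s,a}ᵀ`. -/
def featCov (υ : S × A → ℝ) : Matrix (Fin d) (Fin d) ℝ :=
  Matrix.of fun i j => ∑' x : S × A, υ x * (φ x.1 x.2 i * φ x.1 x.2 j)

/-- The relative condition number `sup_w (wᵀ Σ_υ w) / (wᵀ Σ_ν w)`, with `0 / 0 = 0` and
`c / 0 = ∞` for `c > 0`. -/
def relCond (υ ν : S × A → ℝ) : ℝ≥0∞ :=
  ⨆ w : Fin d → ℝ,
    ENNReal.ofReal (dotProduct w (Matrix.mulVec (featCov φ υ) w)) /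
      ENNReal.ofReal (dotProduct w (Matrix.mulVec (featCov φ ν) w))

/-- The Euclidean projection onto the ball `{w : ‖w‖₂ ≤ W}`. -/
def projBall (W : ℝ) (w : EuclideanSpace ℝ (Fin d)) : EuclideanSpace ℝ (Fin d) :=
  if ‖w‖ ≤ W then w else (W / ‖w‖) • w

variable [Fintype A] [Nonempty A] (M : MDP S A) (ν : PMF (S × A))

/-- `n` steps of projected SGD at the policy parameter `θ`, with a fresh call of the sampler in
every step. The outcome is `(w_n, w_1 + ⋯ + w_n, number of oracle samples used)`. -/
def sgd (W α : ℝ) (θ : EuclideanSpace ℝ (Fin d)) :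
    ℕ → PMF (EuclideanSpace ℝ (Fin d) × EuclideanSpace ℝ (Fin d) × ℕ)
  | 0 => PMF.pure (0, 0, 0)
  | n + 1 => (sgd W α θ n).bind fun c =>
      (M.sampler (logLinear φ θ) ν).map fun o =>
        let f := φ o.1.1 o.1.2
        let w' := projBall W (c.1 - (2 * α * (inner ℝ c.1 f - o.2.1)) • f)
        (w', c.2.1 + w', c.2.2 + o.2.2)

/-- `t` outer iterations of sample-based `Q`-NPG with `N` SGD steps each. The outcome is the
sequence `θ^{(0)}, …, θ^{(t)}` (continued by `0`), and the number of oracle samples used. -/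
def run (W η α : ℝ) (N : ℕ) : ℕ → PMF ((ℕ → EuclideanSpace ℝ (Fin d)) × ℕ)
  | 0 => PMF.pure (fun _ => 0, 0)
  | t + 1 => (run W η α N t).bind fun h =>
      (sgd φ M ν W α (h.1 t) N).map fun c =>
        (Function.update h.1 (t + 1) (h.1 t + η • ((1 / (N : ℝ)) • c.2.1)), h.2 + c.2.2)

end Features

end

end QNPG

namespace QNPG

/-! By the performance difference lemma, `1 - γ` times the gap is the difference of two expectations
of `Q^{π_θ}`, both with states drawn from `d_ρ^{π⋆}`, one with actions from the comparator and one
with actions from `π_θ`. With `w` the averaged SGD output and `z` the regression minimizer, write `Q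
= w·φ + (Q - z·φ) - (w - z)·φ` and treat the three pieces separately.

The linear piece is handled by mirror descent. The update `θ + η w` is exponential weights in every
state, and Hoeffding's lemma shows that the cross entropy of `π_θ` relative to the comparator pays
for it up to `η² (BW)² / 2` (`mirror_descent_step`). The cross entropy is nonnegative and starts at
`log |A|`.

In the other two pieces any policy has density at most `|A|` with respect to the uniform one, so
Jensen bounds each expectation by the root of `|A|` times a second moment under `d⋆`
(`expect_joint_sq_le`). Each piece occurs for two policies, which gives the factor 2. The piece `Q -
z·φ` is the bias. For `(w - z)·φ`, the second moment passes from `d⋆` to `ν` at cost `κ`, and from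
`ν` to `d_ν^π` at cost `1/(1-γ)` (`MDP.quad_le_visit`), where SGD controls it.

The SGD estimate (`expect_quad_average_le_rate`) works although `Q̂` is unbounded: `Q̂` is unbiased
for `Q` given the accepted pair and has second moment at most `2/(1-γ)²`. First-order optimality of
`z` turns the descent inequality into a bound on `E((w - z)·φ)²` of order `N^{-1/2}`, whence
`N^{-1/4}` after the root. The sample count follows from the mean `1/(1-γ)` of one plus a geometric
variable, which occurs twice in each call of the sampler. -/

/-- The expectation of an extended nonnegative function under a discrete law. -/
noncomputable def lexp {α : Type*} (p : PMF α) (f : α → ℝ≥0∞) : ℝ≥0∞ := ∑' x, p x * f x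

/-- The expectation `expect p f` converges absolutely. -/
def HasExpect {α : Type*} (p : PMF α) (f : α → ℝ) : Prop :=
  Summable fun x => (p x).toReal * f x

/-! ### Discrete expectations: integrability, Fubini, Jensen. -/

section Expectation

variable {α β : Type*}

theorem lexp_pure (x : α) (f : α → ℝ≥0∞) : lexp (PMF.pure x) f = f x := by
  unfold lexp
  rw [tsum_eq_single x]
  · simp
  · intro y hy
    simp [PMF.pure_apply, hy]

theorem lexp_bind (p : PMF α) (q : α → PMF β) (f : β → ℝ≥0∞) :
    lexp (p.bind q) f = lexp p fun x => lexp (q x) f := by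
  unfold lexp
  simp only [PMF.bind_apply, ← ENNReal.tsum_mul_right, ← ENNReal.tsum_mul_left, mul_assoc]
  exact ENNReal.tsum_comm

theorem lexp_map (p : PMF α) (g : α → β) (f : β → ℝ≥0∞) :
    lexp (p.map g) f = lexp p fun x => f (g x) := by
  rw [← PMF.bind_pure_comp, lexp_bind]
  simp only [Function.comp, lexp_pure]

theorem lexp_const (p : PMF α) (c : ℝ≥0∞) : lexp p (fun _ => c) = c := by
  unfold lexp
  rw [ENNReal.tsum_mul_right, p.tsum_coe, one_mul]

theorem lexp_add (p : PMF α) (f g : α → ℝ≥0∞) :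
    lexp p (fun x => f x + g x) = lexp p f + lexp p g := by
  unfold lexp
  simp only [mul_add]
  exact ENNReal.tsum_add

theorem lexp_mono (p : PMF α) {f g : α → ℝ≥0∞} (h : ∀ x ∈ p.support, f x ≤ g x) :
    lexp p f ≤ lexp p g := by
  refine ENNReal.tsum_le_tsum fun x => ?_
  by_cases hx : p x = 0
  · simp [hx]
  · gcongr
    exact h x ((p.mem_support_iff x).2 hx)

theorem lexp_congr (p : PMF α) {f g : α → ℝ≥0∞} (h : ∀ x ∈ p.support, f x = g x) :
    lexp p f = lexp p g :=
  le_antisymm (lexp_mono p fun x hx => (h x hx).le) (lexp_mono p fun x hx => (h x hx).ge)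

theorem enorm_toReal_mul (p : PMF α) (f : α → ℝ) (x : α) :
    ‖(p x).toReal * f x‖ₑ = p x * ‖f x‖ₑ := by
  rw [enorm_mul, Real.enorm_eq_ofReal ENNReal.toReal_nonneg,
    ENNReal.ofReal_toReal (p.apply_ne_top x)]

theorem summable_iff_tsum_enorm {f : α → ℝ} : Summable f ↔ ∑' x, ‖f x‖ₑ ≠ ⊤ := by
  rw [← summable_norm_iff]
  change Summable (fun x => ((‖f x‖₊ : ℝ≥0) : ℝ)) ↔ _
  rw [NNReal.summable_coe, ← ENNReal.tsum_coe_ne_top_iff_summable]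
  rfl

/-- A real `tsum` is 0 when it diverges, so integrability has to be tracked. This criterion moves
the question to `lexp`, where sums always exist and can be interchanged freely. -/
theorem hasExpect_iff {p : PMF α} {f : α → ℝ} :
    HasExpect p f ↔ lexp p (fun x => ‖f x‖ₑ) ≠ ⊤ := by
  unfold HasExpect lexp
  rw [summable_iff_tsum_enorm]
  simp only [enorm_toReal_mul]

theorem HasExpect.of_abs_le {p : PMF α} {f g : α → ℝ} (hg : HasExpect p g)
    (h : ∀ x ∈ p.support, |f x| ≤ g x) : HasExpect p f := by
  rw [hasExpect_iff] at *
  refine ne_top_of_le_ne_top hg (lexp_mono p fun x hx => ?_)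
  rw [← Real.enorm_abs (f x)]
  rw [Real.enorm_eq_ofReal_abs, Real.enorm_eq_ofReal_abs, abs_abs]
  exact ENNReal.ofReal_le_ofReal ((h x hx).trans (le_abs_self _))

theorem hasExpect_const (p : PMF α) (c : ℝ) : HasExpect p fun _ => c := by
  rw [hasExpect_iff, lexp_const]
  simp

theorem hasExpect_of_bdd {p : PMF α} {f : α → ℝ} {C : ℝ}
    (h : ∀ x ∈ p.support, |f x| ≤ C) : HasExpect p f :=
  (hasExpect_const p C).of_abs_le h

theorem HasExpect.add {p : PMF α} {f g : α → ℝ} (hf : HasExpect p f) (hg : HasExpect p g) :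
    HasExpect p fun x => f x + g x := by
  unfold HasExpect at *
  simpa only [mul_add] using Summable.add hf hg

theorem HasExpect.sub {p : PMF α} {f g : α → ℝ} (hf : HasExpect p f) (hg : HasExpect p g) :
    HasExpect p fun x => f x - g x := by
  unfold HasExpect at *
  simpa only [mul_sub] using Summable.sub hf hg

theorem HasExpect.const_mul {p : PMF α} {f : α → ℝ} (hf : HasExpect p f) (c : ℝ) :
    HasExpect p fun x => c * f x := by
  unfold HasExpect at *
  simpa only [mul_left_comm] using Summable.mul_left c hf

theorem hasExpect_sum {ι : Type*} {p : PMF α} (s : Finset ι) {f : ι → α → ℝ}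
    (hf : ∀ i ∈ s, HasExpect p (f i)) : HasExpect p fun x => ∑ i ∈ s, f i x := by
  unfold HasExpect at *
  simpa only [Finset.mul_sum] using summable_sum hf

theorem expect_add {p : PMF α} {f g : α → ℝ} (hf : HasExpect p f) (hg : HasExpect p g) :
    expect p (fun x => f x + g x) = expect p f + expect p g := by
  unfold expect
  simpa only [mul_add] using Summable.tsum_add hf hg

theorem expect_sub {p : PMF α} {f g : α → ℝ} (hf : HasExpect p f) (hg : HasExpect p g) :
    expect p (fun x => f x - g x) = expect p f - expect p g := by
  unfold expect
  simpa only [mul_sub] using Summable.tsum_sub hf hg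

theorem expect_const_mul (p : PMF α) (f : α → ℝ) (c : ℝ) :
    expect p (fun x => c * f x) = c * expect p f := by
  unfold expect
  simp only [mul_left_comm _ c, tsum_mul_left]

theorem expect_sum {ι : Type*} {p : PMF α} (s : Finset ι) {f : ι → α → ℝ}
    (hf : ∀ i ∈ s, HasExpect p (f i)) :
    expect p (fun x => ∑ i ∈ s, f i x) = ∑ i ∈ s, expect p (f i) := by
  unfold expect
  simpa only [Finset.mul_sum] using Summable.tsum_finsetSum hf

theorem tsum_toReal (p : PMF α) : ∑' x, (p x).toReal = 1 := by
  rw [← ENNReal.tsum_toReal_eq fun x => p.apply_ne_top x, p.tsum_coe, ENNReal.toReal_one]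

theorem expect_const (p : PMF α) (c : ℝ) : expect p (fun _ => c) = c := by
  unfold expect
  rw [tsum_mul_right, tsum_toReal, one_mul]

theorem toReal_mul_congr {p : PMF α} {f g : α → ℝ} (h : ∀ x ∈ p.support, f x = g x) (x : α) :
    (p x).toReal * f x = (p x).toReal * g x := by
  by_cases hx : p x = 0
  · simp [hx]
  · rw [h x ((p.mem_support_iff x).2 hx)]

theorem expect_congr {p : PMF α} {f g : α → ℝ} (h : ∀ x ∈ p.support, f x = g x) :
    expect p f = expect p g :=
  tsum_congr (toReal_mul_congr h)

theorem HasExpect.congr {p : PMF α} {f g : α → ℝ} (hf : HasExpect p f)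
    (h : ∀ x ∈ p.support, f x = g x) : HasExpect p g :=
  Summable.congr hf fun x => toReal_mul_congr h x

theorem expect_mono {p : PMF α} {f g : α → ℝ} (hf : HasExpect p f) (hg : HasExpect p g)
    (h : ∀ x ∈ p.support, f x ≤ g x) : expect p f ≤ expect p g := by
  refine Summable.tsum_le_tsum (fun x => ?_) hf hg
  by_cases hx : p x = 0
  · simp [hx]
  · exact mul_le_mul_of_nonneg_left (h x ((p.mem_support_iff x).2 hx)) ENNReal.toReal_nonneg

theorem expect_nonneg {p : PMF α} {f : α → ℝ} (h : ∀ x, 0 ≤ f x) : 0 ≤ expect p f :=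
  tsum_nonneg fun x => mul_nonneg ENNReal.toReal_nonneg (h x)

theorem expect_le {p : PMF α} {f : α → ℝ} {C : ℝ} (hf : HasExpect p f)
    (h : ∀ x ∈ p.support, f x ≤ C) : expect p f ≤ C :=
  (expect_mono hf (hasExpect_const p C) h).trans_eq (expect_const p C)

theorem abs_expect_le {p : PMF α} {f : α → ℝ} {C : ℝ} (h : ∀ x ∈ p.support, |f x| ≤ C) :
    |expect p f| ≤ C := by
  have hf := hasExpect_of_bdd h
  rw [abs_le]
  refine ⟨?_, expect_le hf fun x hx => (abs_le.1 (h x hx)).2⟩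
  rw [← expect_const p (-C)]
  exact expect_mono (hasExpect_const p _) hf fun x hx => (abs_le.1 (h x hx)).1

theorem expect_pure (x : α) (f : α → ℝ) : expect (PMF.pure x) f = f x := by
  unfold expect
  rw [tsum_eq_single x]
  · simp
  · intro y hy
    simp [PMF.pure_apply, hy]

/-- Tonelli for the absolute values, which is the hypothesis needed to exchange the two sums in
`expect_bind`. -/
theorem summable_bind_kernel {p : PMF α} {q : α → PMF β} {f : β → ℝ}
    (h : HasExpect (p.bind q) f) :
    Summable fun z : α × β => (p z.1).toReal * ((q z.1 z.2).toReal * f z.2) := by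
  rw [summable_iff_tsum_enorm]
  rw [hasExpect_iff, lexp_bind] at h
  convert h using 1
  rw [ENNReal.tsum_prod']
  unfold lexp
  refine tsum_congr fun x => ?_
  rw [← ENNReal.tsum_mul_left]
  refine tsum_congr fun y => ?_
  rw [enorm_mul, enorm_toReal_mul, Real.enorm_eq_ofReal ENNReal.toReal_nonneg,
    ENNReal.ofReal_toReal (p.apply_ne_top x)]

theorem toReal_bind_apply (p : PMF α) (q : α → PMF β) (y : β) :
    (p.bind q y).toReal = ∑' x, (p x).toReal * (q x y).toReal := by
  rw [PMF.bind_apply, ENNReal.tsum_toReal_eq]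
  · simp only [ENNReal.toReal_mul]
  · exact fun x => ENNReal.mul_ne_top (p.apply_ne_top x) ((q x).apply_ne_top y)

theorem expect_bind {p : PMF α} {q : α → PMF β} {f : β → ℝ} (h : HasExpect (p.bind q) f) :
    expect (p.bind q) f = expect p fun x => expect (q x) f := by
  have hs := summable_bind_kernel h
  unfold expect
  simp only [toReal_bind_apply, ← tsum_mul_right, ← tsum_mul_left, mul_assoc]
  exact hs.tsum_comm (f := fun x y => (p x).toReal * ((q x y).toReal * f y))

theorem HasExpect.bind {p : PMF α} {q : α → PMF β} {f : β → ℝ} (h : HasExpect (p.bind q) f) :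
    HasExpect p fun x => expect (q x) f := by
  have := (summable_bind_kernel h).prod
  simp only [tsum_mul_left] at this
  exact this

/-- A single kernel of positive mass with infinite absolute expectation would make that of the
mixture infinite. -/
theorem HasExpect.bind_kernel {p : PMF α} {q : α → PMF β} {f : β → ℝ}
    (h : HasExpect (p.bind q) f) {x : α} (hx : x ∈ p.support) : HasExpect (q x) f := by
  rw [hasExpect_iff, lexp_bind] at h
  rw [hasExpect_iff]
  intro ht
  refine h (top_le_iff.1 (le_trans (le_of_eq ?_)
    (ENNReal.le_tsum (f := fun x => p x * lexp (q x) fun y => ‖f y‖ₑ) x)))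
  rw [ht, ENNReal.mul_top ((p.mem_support_iff x).1 hx)]

theorem HasExpect.abs {p : PMF α} {f : α → ℝ} (hf : HasExpect p f) :
    HasExpect p fun x => |f x| := by
  rw [hasExpect_iff] at *
  simpa only [Real.enorm_abs] using hf

theorem hasExpect_map {p : PMF α} {g : α → β} {f : β → ℝ} :
    HasExpect (p.map g) f ↔ HasExpect p fun x => f (g x) := by
  rw [hasExpect_iff, hasExpect_iff, lexp_map]

theorem expect_map {p : PMF α} {g : α → β} {f : β → ℝ} (h : HasExpect p fun x => f (g x)) :
    expect (p.map g) f = expect p fun x => f (g x) := by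
  have h' := hasExpect_map.2 h
  rw [← PMF.bind_pure_comp] at h' ⊢
  rw [expect_bind h']
  simp only [Function.comp, expect_pure]

/-- Nonnegativity of the variance. -/
theorem expect_sq_le {p : PMF α} {f : α → ℝ} (hf : HasExpect p f)
    (h2 : HasExpect p fun x => f x ^ 2) : expect p f ^ 2 ≤ expect p fun x => f x ^ 2 := by
  have h : 0 ≤ expect p fun x => (f x - expect p f) ^ 2 := expect_nonneg fun x => sq_nonneg _
  have e : (fun x => (f x - expect p f) ^ 2) =
      fun x => (f x ^ 2 - 2 * expect p f * f x) + expect p f ^ 2 := by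
    funext x; ring
  rw [e, expect_add (h2.sub (hf.const_mul _)) (hasExpect_const _ _), expect_const,
    expect_sub h2 (hf.const_mul _), expect_const_mul] at h
  linarith

theorem HasExpect.sqrt {p : PMF α} {f : α → ℝ} (hf : HasExpect p f) (h0 : ∀ x, 0 ≤ f x) :
    HasExpect p fun x => Real.sqrt (f x) := by
  refine ((hasExpect_const p 1).add hf).of_abs_le fun x _ => ?_
  rw [abs_of_nonneg (Real.sqrt_nonneg _)]
  nlinarith [Real.sq_sqrt (h0 x), sq_nonneg (Real.sqrt (f x) - 1), Real.sqrt_nonneg (f x)]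

theorem expect_sqrt_le {p : PMF α} {f : α → ℝ} (hf : HasExpect p f) (h0 : ∀ x, 0 ≤ f x) :
    expect p (fun x => Real.sqrt (f x)) ≤ Real.sqrt (expect p f) := by
  have e : (fun x => Real.sqrt (f x) ^ 2) = f := funext fun x => Real.sq_sqrt (h0 x)
  refine Real.le_sqrt_of_sq_le ?_
  have := expect_sq_le (hf.sqrt h0) (e.symm ▸ hf)
  rwa [e] at this

theorem expect_eq_sum [Fintype α] (p : PMF α) (f : α → ℝ) :
    expect p f = ∑ x, (p x).toReal * f x :=
  tsum_fintype _

end Expectation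

/-! ### The geometrically stopped chain and its fixed-point equation. -/

section Loop

variable {α β : Type*} {γ : ℝ} (h0 : 0 ≤ γ) (h1 : γ < 1)

theorem geom_toReal (n : ℕ) : (geom γ h0 h1 n).toReal = (1 - γ) * γ ^ n :=
  ENNReal.toReal_ofReal (mul_nonneg (by linarith) (pow_nonneg h0 n))

theorem expect_geom (f : ℕ → ℝ) :
    expect (geom γ h0 h1) f = (1 - γ) * ∑' n, γ ^ n * f n := by
  unfold expect
  simp only [geom_toReal, mul_assoc, tsum_mul_left]

/-- Conditioning on the first coin: a bounded function averaged over the stopped chain solves a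
Bellman-type equation. Together with `eq_zero_of_fixed` this replaces manipulations of discounted
series. -/
theorem expect_loop (step : α → PMF α) {f : α → ℝ} {C : ℝ} (hf : ∀ x, |f x| ≤ C) (x : α) :
    expect (loop γ h0 h1 step x) f =
      (1 - γ) * f x + γ * expect (step x) fun y => expect (loop γ h0 h1 step y) f := by
  have hb : ∀ p : PMF α, HasExpect p f := fun p => hasExpect_of_bdd fun y _ => hf y
  rw [← expect_bind (hb _), ← expect_pure x f]
  unfold expect
  rw [← tsum_mul_left, ← tsum_mul_left, ← Summable.tsum_add]
  · refine tsum_congr fun y => ?_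
    rw [loop_apply, ENNReal.toReal_add, ENNReal.toReal_mul, ENNReal.toReal_mul,
      ENNReal.toReal_ofReal h0, ENNReal.toReal_ofReal (by linarith)]
    · ring
    · exact ENNReal.mul_ne_top ENNReal.ofReal_ne_top (PMF.apply_ne_top _ _)
    · exact ENNReal.mul_ne_top ENNReal.ofReal_ne_top (PMF.apply_ne_top _ _)
  · exact Summable.mul_left _ (hb _)
  · exact Summable.mul_left _ (hb _)

/-- A bounded solution of `D = f + γ E D` vanishes if `f = 0`. -/
theorem eq_zero_of_fixed (h0 : 0 ≤ γ) (h1 : γ < 1) (step : α → PMF α) {D : α → ℝ} {C : ℝ} (hD : ∀ x, |D x| ≤ C)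
    (h : ∀ x, D x = γ * expect (step x) D) (x : α) : D x = 0 := by
  have key : ∀ n : ℕ, ∀ x, |D x| ≤ γ ^ n * C := by
    intro n
    induction n with
    | zero => simpa using hD
    | succ n ih =>
      intro x
      rw [h x, abs_mul, abs_of_nonneg h0, pow_succ', mul_assoc]
      exact mul_le_mul_of_nonneg_left (abs_expect_le fun y _ => ih y) h0
  have hlim : Filter.Tendsto (fun n : ℕ => γ ^ n * C) Filter.atTop (nhds 0) := by
    simpa using (tendsto_pow_atTop_nhds_zero_of_lt_one h0 h1).mul_const C
  exact abs_nonpos_iff.1 (ge_of_tendsto' hlim fun n => key n x)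

end Loop

/-! ### State laws combined with policies. -/

/-- The law of `(s, a)` with `s ∼ p` and `a ∼ π(· | s)`. -/
noncomputable def joint {S A : Type*} (p : PMF S) (π : S → PMF A) : PMF (S × A) :=
  p.bind fun s => (π s).map (Prod.mk s)

section Joint

variable {S A : Type*}

theorem joint_apply (p : PMF S) (π : S → PMF A) (x : S × A) :
    joint p π x = p x.1 * π x.1 x.2 := by
  classical
  obtain ⟨s, a⟩ := x
  rw [joint, PMF.bind_apply, tsum_eq_single s]
  · rw [PMF.map_apply, tsum_eq_single a]
    · simp
    · intro b hb
      simp [hb.symm]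
  · intro s' hs
    rw [PMF.map_apply]
    simp [hs.symm]

theorem expect_joint {p : PMF S} {π : S → PMF A} {f : S × A → ℝ} {C : ℝ}
    (hf : ∀ x, |f x| ≤ C) :
    expect (joint p π) f = expect p fun s => expect (π s) fun a => f (s, a) := by
  rw [joint, expect_bind (hasExpect_of_bdd fun x _ => hf x)]
  refine expect_congr fun s _ => ?_
  exact expect_map (hasExpect_of_bdd fun a _ => hf (s, a))

theorem joint_bind {α : Type*} (p : PMF α) (q : α → PMF S) (π : S → PMF A) :
    joint (p.bind q) π = p.bind fun x => joint (q x) π := by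
  simp only [joint, PMF.bind_bind]

theorem map_fst_joint (p : PMF S) (π : S → PMF A) : (joint p π).map Prod.fst = p := by
  simp only [joint, PMF.map_bind, PMF.map_comp]
  have : ∀ s, PMF.map (Prod.fst ∘ Prod.mk s) (π s) = PMF.pure s := fun s => PMF.map_const _ _
  simp only [this, PMF.bind_pure]

end Joint

/-! ### Visitation laws, Bellman equations and the performance difference lemma. -/

section Dynamics

variable {S A : Type*} (M : MDP S A) (π : S → PMF A)

theorem MDP.one_sub_pos : 0 < 1 - M.γ := by linarith [M.γ_lt_one]

theorem MDP.abs_r_le (x : S × A) : |M.r x.1 x.2| ≤ 1 :=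
  abs_le.2 ⟨by linarith [M.r_nonneg x.1 x.2], M.r_le_one _ _⟩

/-- The law of the state-action pair at a geometric time, started at a pair. -/
noncomputable def MDP.visitFrom (x : S × A) : PMF (S × A) :=
  loop M.γ M.γ_nonneg M.γ_lt_one (M.next π) x

/-- The visitation distribution `d_ν^π` as a law. -/
noncomputable def MDP.visitPMF (ν : PMF (S × A)) : PMF (S × A) := ν.bind (M.visitFrom π)

/-- The state visitation distribution `d_ρ^π` as a law. -/
noncomputable def MDP.stateVisitPMF (ρ : PMF S) : PMF S :=
  ρ.bind fun s => (geom M.γ M.γ_nonneg M.γ_lt_one).bind fun t => (M.law π s t).map Prod.fst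

theorem MDP.next_eq_joint (x : S × A) : M.next π x = joint (M.P x.1 x.2) π := rfl

theorem MDP.visit_eq (ν : PMF (S × A)) (x : S × A) :
    M.visit π ν x = (M.visitPMF π ν x).toReal := by
  rw [MDP.visitPMF, toReal_bind_apply, MDP.visit, ← expect_const_mul]
  refine tsum_congr fun y => ?_
  rw [MDP.visitFrom, loop, toReal_bind_apply]
  simp only [geom_toReal, mul_assoc, tsum_mul_left]
  rfl

theorem MDP.stateVisit_eq (ρ : PMF S) (s : S) :
    M.stateVisit π ρ s = (M.stateVisitPMF π ρ s).toReal := by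
  rw [MDP.stateVisitPMF, toReal_bind_apply, MDP.stateVisit]
  refine tsum_congr fun y => ?_
  rw [toReal_bind_apply]
  simp only [geom_toReal, mul_assoc, tsum_mul_left]

theorem MDP.dStar_eq [Fintype A] [Nonempty A] (ρ : PMF S) (x : S × A) :
    M.dStar π ρ x =
      (joint (M.stateVisitPMF π ρ) (fun _ => PMF.uniformOfFintype A) x).toReal := by
  rw [joint_apply, ENNReal.toReal_mul, MDP.dStar, MDP.stateVisit_eq]
  simp

/-- Discounting is stopping at a geometric time, up to the normalization `1 - γ`; thus `Q` becomes
an expectation under a probability law. -/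
theorem MDP.Q_eq (x : S × A) :
    M.Q π x = (1 - M.γ)⁻¹ * expect (M.visitFrom π x) fun y => M.r y.1 y.2 := by
  rw [MDP.visitFrom, loop, expect_bind (hasExpect_of_bdd fun y _ => M.abs_r_le y), expect_geom,
    inv_mul_cancel_left₀ M.one_sub_pos.ne']
  rfl

theorem MDP.Q_nonneg (x : S × A) : 0 ≤ M.Q π x := by
  rw [M.Q_eq]
  exact mul_nonneg (inv_nonneg.2 M.one_sub_pos.le) (expect_nonneg fun y => M.r_nonneg _ _)

theorem MDP.Q_le (x : S × A) : M.Q π x ≤ (1 - M.γ)⁻¹ := by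
  rw [M.Q_eq]
  refine mul_le_of_le_one_right (inv_nonneg.2 M.one_sub_pos.le) ?_
  exact expect_le (hasExpect_of_bdd fun y _ => M.abs_r_le y) fun y _ => M.r_le_one _ _

theorem MDP.abs_Q_le (x : S × A) : |M.Q π x| ≤ (1 - M.γ)⁻¹ := by
  rw [abs_of_nonneg (M.Q_nonneg π x)]
  exact M.Q_le π x

theorem MDP.V_eq (s : S) : M.V π s = expect (π s) fun a => M.Q π (s, a) := by
  have e : (geom M.γ M.γ_nonneg M.γ_lt_one).bind (M.law π s) =
      (π s).bind fun a => M.visitFrom π (s, a) := PMF.bind_comm _ _ _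
  have hb : ∀ p : PMF (S × A), HasExpect p fun y => M.r y.1 y.2 :=
    fun p => hasExpect_of_bdd fun y _ => M.abs_r_le y
  have h : M.V π s = (1 - M.γ)⁻¹ *
      expect ((geom M.γ M.γ_nonneg M.γ_lt_one).bind (M.law π s)) fun y => M.r y.1 y.2 := by
    rw [expect_bind (hb _), expect_geom, inv_mul_cancel_left₀ M.one_sub_pos.ne']
    rfl
  rw [h, e, expect_bind (hb _), ← expect_const_mul]
  simp only [M.Q_eq]

theorem MDP.abs_V_le (s : S) : |M.V π s| ≤ (1 - M.γ)⁻¹ := by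
  rw [M.V_eq]
  exact abs_expect_le fun a _ => M.abs_Q_le π _

theorem MDP.bellman_next (x : S × A) :
    M.Q π x = M.r x.1 x.2 + M.γ * expect (M.next π x) (M.Q π) := by
  have h : (M.Q π) = fun y => (1 - M.γ)⁻¹ * expect (M.visitFrom π y) fun y => M.r y.1 y.2 :=
    funext (M.Q_eq π)
  rw [M.Q_eq, MDP.visitFrom, expect_loop _ _ _ M.abs_r_le, h, expect_const_mul]
  have := M.one_sub_pos.ne'
  simp only [MDP.visitFrom]
  field_simp

theorem MDP.bellman (x : S × A) :
    M.Q π x = M.r x.1 x.2 + M.γ * expect (M.P x.1 x.2) (M.V π) := by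
  rw [M.bellman_next, M.next_eq_joint, expect_joint (M.abs_Q_le π)]
  simp only [← M.V_eq]

theorem MDP.lawFrom_succ (x : S × A) (t : ℕ) :
    M.lawFrom π x (t + 1) = (M.P x.1 x.2).bind fun s => M.law π s t := by
  change (M.next π x).bind (iter (M.next π) t) = _
  rw [MDP.next, PMF.bind_bind]
  simp only [PMF.bind_map]
  rfl

/-- At every time the action is drawn afresh from `π` given the current state, so the pair law is
determined by its state marginal. This is what lets the performance difference be written with state
visitation alone. -/
theorem MDP.law_eq_joint (s : S) (t : ℕ) :
    M.law π s t = joint ((M.law π s t).map Prod.fst) π := by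
  induction t generalizing s with
  | zero =>
    have h : M.law π s 0 = joint (PMF.pure s) π := by
      rw [joint, PMF.pure_bind]
      exact PMF.bind_pure_comp _ _
    rw [h, map_fst_joint]
  | succ t ih =>
    have h : M.law π s (t + 1) =
        joint ((π s).bind fun a => (M.P s a).bind fun s' => (M.law π s' t).map Prod.fst) π := by
      simp only [joint_bind, ← ih]
      unfold MDP.law
      simp only [M.lawFrom_succ]
      rfl
    rw [h, map_fst_joint]

theorem MDP.bind_law_eq_joint (ρ : PMF S) :
    (ρ.bind fun s => (π s).bind fun a => M.visitFrom π (s, a)) =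
      joint (M.stateVisitPMF π ρ) π := by
  simp only [MDP.stateVisitPMF, joint_bind, ← M.law_eq_joint]
  congr 1
  funext s
  exact PMF.bind_comm _ _ _

/-- The advantage is bounded. -/
theorem MDP.abs_adv_le (x : S × A) : |M.Q π x - M.V π x.1| ≤ 2 * (1 - M.γ)⁻¹ := by
  refine (abs_sub _ _).trans ?_
  linarith [M.abs_Q_le π x, M.abs_V_le π x.1]

/-- The performance difference lemma started at a state-action pair. -/
theorem MDP.performance_difference_pair (π' : S → PMF A) (x : S × A) :
    M.Q π' x - M.V π x.1 =
      (1 - M.γ)⁻¹ * expect (M.visitFrom π' x) fun y => M.Q π y - M.V π y.1 := by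
  set F : S × A → ℝ := fun x =>
    (1 - M.γ)⁻¹ * expect (M.visitFrom π' x) fun y => M.Q π y - M.V π y.1 with hF
  have hFb : ∀ x, |F x| ≤ (1 - M.γ)⁻¹ * (2 * (1 - M.γ)⁻¹) := by
    intro x
    have hp := inv_pos.2 M.one_sub_pos
    rw [hF, abs_mul, abs_of_pos hp]
    exact mul_le_mul_of_nonneg_left (abs_expect_le fun y _ => M.abs_adv_le π y) hp.le
  have hFe : ∀ x, F x = (M.Q π x - M.V π x.1) + M.γ * expect (M.next π' x) F := by
    intro x
    have := M.one_sub_pos.ne'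
    simp only [hF]
    rw [expect_const_mul]
    simp only [MDP.visitFrom]
    rw [expect_loop _ _ _ (M.abs_adv_le π)]
    field_simp
  have hDb : ∀ x, |M.Q π' x - M.V π x.1| ≤ 2 * (1 - M.γ)⁻¹ := by
    intro x
    refine (abs_sub _ _).trans ?_
    linarith [M.abs_Q_le π' x, M.abs_V_le π x.1]
  have hDe : ∀ x, M.Q π' x - M.V π x.1 =
      (M.Q π x - M.V π x.1) + M.γ * expect (M.next π' x) fun y => M.Q π' y - M.V π y.1 := by
    intro x
    rw [expect_sub (hasExpect_of_bdd fun y _ => M.abs_Q_le π' y)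
      (hasExpect_of_bdd fun y _ => M.abs_V_le π y.1), M.bellman_next π' x, M.bellman π x]
    have : expect (M.next π' x) (fun y => M.V π y.1) = expect (M.P x.1 x.2) (M.V π) := by
      rw [M.next_eq_joint, expect_joint fun y => M.abs_V_le π y.1]
      simp only [expect_const]
    rw [this]
    ring
  -- Both sides are bounded solutions of the same equation `D = advantage + γ E D` for the chain of
  -- `π'`, so their difference is a bounded solution of the homogeneous equation.
  have := eq_zero_of_fixed M.γ_nonneg M.γ_lt_one (M.next π')
    (D := fun x => (M.Q π' x - M.V π x.1) - F x)
    (C := 2 * (1 - M.γ)⁻¹ + (1 - M.γ)⁻¹ * (2 * (1 - M.γ)⁻¹))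
    (fun x => (abs_sub _ _).trans (add_le_add (hDb x) (hFb x)))
    (fun x => by
      rw [expect_sub (hasExpect_of_bdd fun y _ => hDb y) (hasExpect_of_bdd fun y _ => hFb y)]
      linarith [hDe x, hFe x]) x
  exact sub_eq_zero.1 this

/-- The performance difference lemma. -/
theorem MDP.performance_difference (π' : S → PMF A) (ρ : PMF S) :
    M.value π' ρ - M.value π ρ =
      (1 - M.γ)⁻¹ * expect (M.stateVisitPMF π' ρ) fun s =>
        expect (π' s) (fun a => M.Q π (s, a)) - expect (π s) (fun a => M.Q π (s, a)) := by
  have hb : ∀ p : PMF (S × A), HasExpect p fun y => M.Q π y - M.V π y.1 :=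
    fun p => hasExpect_of_bdd fun y _ => M.abs_adv_le π y
  have h1 : (fun s => expect (π' s) (fun a => M.Q π (s, a)) -
      expect (π s) (fun a => M.Q π (s, a))) =
      fun s => expect (π' s) fun a => M.Q π (s, a) - M.V π s := by
    funext s
    rw [expect_sub (hasExpect_of_bdd fun a _ => M.abs_Q_le π (s, a)) (hasExpect_const _ _),
      expect_const, M.V_eq]
  rw [h1, ← expect_joint (f := fun y => M.Q π y - M.V π y.1) (M.abs_adv_le π),
    ← M.bind_law_eq_joint, expect_bind (hb _), MDP.value, MDP.value,
    ← expect_sub (hasExpect_of_bdd fun s _ => M.abs_V_le π' s)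
      (hasExpect_of_bdd fun s _ => M.abs_V_le π s), ← expect_const_mul]
  refine expect_congr fun s _ => ?_
  rw [expect_bind (hb _), ← expect_const_mul, M.V_eq π' s]
  simp only [← M.performance_difference_pair]
  rw [expect_sub (hasExpect_of_bdd fun a _ => M.abs_Q_le π' (s, a)) (hasExpect_const _ _),
    expect_const]

end Dynamics

/-! ### Images of stopped chains and moments of the geometric law. -/

section Loop

variable {α β : Type*}

/-- If `f` intertwines two chains, it does so for all iterates. It serves to forget the sample
counter in the search phase. -/
theorem iter_map {step : α → PMF α} {step' : β → PMF β} {f : α → β}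
    (h : ∀ x, (step x).map f = step' (f x)) (n : ℕ) (x : α) :
    (iter step n x).map f = iter step' n (f x) := by
  induction n generalizing x with
  | zero => exact PMF.pure_map f x
  | succ n ih =>
    change ((step x).bind (iter step n)).map f = (step' (f x)).bind (iter step' n)
    rw [PMF.map_bind, ← h x, PMF.bind_map]
    exact congrArg _ (funext ih)

theorem loop_map {γ : ℝ} (h0 : 0 ≤ γ) (h1 : γ < 1) {step : α → PMF α} {step' : β → PMF β}
    {f : α → β} (h : ∀ x, (step x).map f = step' (f x)) (x : α) :
    (loop γ h0 h1 step x).map f = loop γ h0 h1 step' (f x) := by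
  simp only [loop, PMF.map_bind, iter_map h]

theorem lexp_geom {γ : ℝ} (h0 : 0 ≤ γ) (h1 : γ < 1) {f : ℕ → ℝ} (hf : ∀ n, 0 ≤ f n) {a : ℝ}
    (h : HasSum (fun n => γ ^ n * f n) a) :
    lexp (geom γ h0 h1) (fun n => ENNReal.ofReal (f n)) = ENNReal.ofReal ((1 - γ) * a) := by
  have hg : ∀ n, 0 ≤ (1 - γ) * (γ ^ n * f n) := fun n =>
    mul_nonneg (by linarith) (mul_nonneg (pow_nonneg h0 n) (hf n))
  have hs := h.mul_left (1 - γ)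
  rw [← hs.tsum_eq, ENNReal.ofReal_tsum_of_nonneg hg hs.summable]
  refine tsum_congr fun n => ?_
  rw [← mul_assoc, ENNReal.ofReal_mul (mul_nonneg (by linarith) (pow_nonneg h0 n))]
  rfl

theorem hasSum_geometric_mul_succ {γ : ℝ} (h0 : 0 ≤ γ) (h1 : γ < 1) :
    HasSum (fun n : ℕ => γ ^ n * ((n : ℝ) + 1)) (1 / (1 - γ) ^ 2) := by
  have h := hasSum_choose_mul_geometric_of_norm_lt_one 1
    (r := γ) (by rwa [Real.norm_eq_abs, abs_of_nonneg h0])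
  have e : (fun n : ℕ => γ ^ n * ((n : ℝ) + 1)) =
      fun n => ((n + 1).choose 1 : ℝ) * γ ^ n := by
    funext n
    rw [Nat.choose_one_right]
    push_cast
    ring
  rw [e]
  exact h

theorem lexp_geom_succ {γ : ℝ} (h0 : 0 ≤ γ) (h1 : γ < 1) :
    lexp (geom γ h0 h1) (fun n => 1 + (n : ℝ≥0∞)) = ENNReal.ofReal (1 - γ)⁻¹ := by
  have h := lexp_geom h0 h1 (fun n => by positivity) (hasSum_geometric_mul_succ h0 h1)
  have hp : 1 - γ ≠ 0 := by linarith
  have e : (1 - γ) * (1 / (1 - γ) ^ 2) = (1 - γ)⁻¹ := by field_simp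
  rw [e] at h
  rw [← h]
  refine lexp_congr _ fun n _ => ?_
  rw [ENNReal.ofReal_add n.cast_nonneg zero_le_one, ENNReal.ofReal_natCast, ENNReal.ofReal_one,
    add_comm]

theorem lexp_geom_succ_sq_le {γ : ℝ} (h0 : 0 ≤ γ) (h1 : γ < 1) :
    lexp (geom γ h0 h1) (fun n => ENNReal.ofReal (((n : ℝ) + 1) ^ 2)) ≤
      ENNReal.ofReal (2 * (1 - γ)⁻¹ ^ 2) := by
  have h2 := hasSum_choose_mul_geometric_of_norm_lt_one 2
    (r := γ) (by rwa [Real.norm_eq_abs, abs_of_nonneg h0])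
  have hs := (h2.mul_left 2).sub (hasSum_geometric_mul_succ h0 h1)
  have hs' : HasSum (fun n : ℕ => γ ^ n * (((n : ℝ) + 1) ^ 2))
      (2 * (1 / (1 - γ) ^ (2 + 1)) - 1 / (1 - γ) ^ 2) := by
    -- The identity `(n + 1)² = 2 * (n + 2).choose 2 - (n + 1)` reduces the second moment to known
    -- binomial series.
    have e : (fun n : ℕ => γ ^ n * (((n : ℝ) + 1) ^ 2)) =
        fun n : ℕ => 2 * (((n + 2).choose 2 : ℝ) * γ ^ n) - γ ^ n * ((n : ℝ) + 1) := by
      funext n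
      rw [Nat.cast_choose_two]
      push_cast
      ring
    rw [e]
    exact hs
  rw [lexp_geom h0 h1 (fun n => by positivity) hs']
  refine ENNReal.ofReal_le_ofReal ?_
  have hp : 0 < 1 - γ := by linarith
  have e : (1 - γ) * (2 * (1 / (1 - γ) ^ (2 + 1)) - 1 / (1 - γ) ^ 2) =
      2 * (1 - γ)⁻¹ ^ 2 - (1 - γ)⁻¹ := by
    field_simp
    ring
  rw [e]
  linarith [inv_pos.2 hp]

end Loop

theorem HasExpect.of_lexp_le {α : Type*} {p : PMF α} {f : α → ℝ} (hf : ∀ x, 0 ≤ f x) {C : ℝ}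
    (h : lexp p (fun x => ENNReal.ofReal (f x)) ≤ ENNReal.ofReal C) : HasExpect p f := by
  rw [hasExpect_iff]
  refine ne_top_of_le_ne_top ENNReal.ofReal_ne_top (le_trans (le_of_eq ?_) h)
  simp only [Real.enorm_eq_ofReal (hf _)]

theorem expect_le_of_lexp_le {α : Type*} {p : PMF α} {f : α → ℝ} (hf : ∀ x, 0 ≤ f x) {C : ℝ}
    (hC : 0 ≤ C) (h : lexp p (fun x => ENNReal.ofReal (f x)) ≤ ENNReal.ofReal C) :
    expect p f ≤ C := by
  have hs := HasExpect.of_lexp_le hf h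
  rw [← ENNReal.ofReal_le_ofReal_iff hC]
  refine le_trans (le_of_eq ?_) h
  unfold expect lexp
  rw [ENNReal.ofReal_tsum_of_nonneg (fun x => mul_nonneg ENNReal.toReal_nonneg (hf x)) hs]
  refine tsum_congr fun x => ?_
  rw [ENNReal.ofReal_mul ENNReal.toReal_nonneg, ENNReal.ofReal_toReal (p.apply_ne_top x)]

/-! ### The sampler: accepted pair, unbiasedness, second moment and cost. -/

section Sampler

variable {S A : Type*} (M : MDP S A) (π : S → PMF A)

/-- One step of the search for the accepted pair, counting samples. -/
noncomputable def MDP.searchStep (c : (S × A) × ℕ) : PMF ((S × A) × ℕ) :=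
  (M.next π c.1).map fun y => (y, c.2 + 1)

/-- One step of the rollout, accumulating rewards and counting samples. -/
noncomputable def MDP.rolloutStep (e : (S × A) × ℝ × ℕ) : PMF ((S × A) × ℝ × ℕ) :=
  (M.next π e.1).map fun y => (y, e.2.1 + M.r y.1 y.2, e.2.2 + 1)

/-- The search for the accepted pair. -/
noncomputable def MDP.search (c : (S × A) × ℕ) : PMF ((S × A) × ℕ) :=
  loop M.γ M.γ_nonneg M.γ_lt_one (M.searchStep π) c

/-- The rollout that starts at an accepted pair. -/
noncomputable def MDP.rollout (c : (S × A) × ℕ) : PMF ((S × A) × ℝ × ℕ) :=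
  loop M.γ M.γ_nonneg M.γ_lt_one (M.rolloutStep π) (c.1, M.r c.1.1 c.1.2, c.2 + 1)

theorem MDP.sampler_eq (ν : PMF (S × A)) :
    M.sampler π ν = ν.bind fun x => (M.search π (x, 1)).bind fun c =>
      (M.rollout π c).map fun e => (c.1, e.2.1, e.2.2) := rfl

theorem MDP.search_map_fst (c : (S × A) × ℕ) :
    (M.search π c).map Prod.fst = M.visitFrom π c.1 := by
  refine loop_map _ _ (fun x => ?_) c
  rw [MDP.searchStep, PMF.map_comp]
  exact PMF.map_id _

theorem MDP.mem_support_iter_search {n : ℕ} {c e : (S × A) × ℕ}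
    (h : e ∈ (iter (M.searchStep π) n c).support) : e.2 = c.2 + n := by
  induction n generalizing c with
  | zero =>
    rw [iter, PMF.mem_support_pure_iff] at h
    simp [h]
  | succ n ih =>
    rw [iter, PMF.mem_support_bind_iff] at h
    obtain ⟨y, hy, h⟩ := h
    rw [MDP.searchStep, PMF.mem_support_map_iff] at hy
    obtain ⟨z, -, rfl⟩ := hy
    rw [ih h]
    simp only
    omega

/-- For a fixed number of steps the counter is deterministic and the added reward lies in `[0, n]`.
Hence all randomness in the cost, and the bound on `Q̂²`, comes from the geometric time. -/
theorem MDP.mem_support_iter_rollout {n : ℕ} {c e : (S × A) × ℝ × ℕ}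
    (h : e ∈ (iter (M.rolloutStep π) n c).support) :
    c.2.1 ≤ e.2.1 ∧ e.2.1 ≤ c.2.1 + n ∧ e.2.2 = c.2.2 + n := by
  induction n generalizing c with
  | zero =>
    rw [iter, PMF.mem_support_pure_iff] at h
    simp [h]
  | succ n ih =>
    rw [iter, PMF.mem_support_bind_iff] at h
    obtain ⟨y, hy, h⟩ := h
    rw [MDP.rolloutStep, PMF.mem_support_map_iff] at hy
    obtain ⟨z, -, rfl⟩ := hy
    obtain ⟨h1, h2, h3⟩ := ih h
    simp only at h1 h2 h3
    have := M.r_nonneg z.1 z.2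
    have := M.r_le_one z.1 z.2
    push_cast
    refine ⟨by linarith, by linarith, by omega⟩

theorem MDP.expect_iter_rollout (n : ℕ) (e : (S × A) × ℝ × ℕ) :
    expect (iter (M.rolloutStep π) n e) (fun c => c.2.1) =
      e.2.1 + ∑ t ∈ Finset.range n,
        expect (M.lawFrom π e.1 (t + 1)) fun y => M.r y.1 y.2 := by
  have hb : ∀ n e, HasExpect (iter (M.rolloutStep π) n e) fun c => c.2.1 := fun n e =>
    hasExpect_of_bdd (C := |e.2.1| + n) fun c hc => by
      obtain ⟨h1, h2, -⟩ := M.mem_support_iter_rollout π hc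
      have := neg_abs_le e.2.1
      have := le_abs_self e.2.1
      have : (0 : ℝ) ≤ n := n.cast_nonneg
      exact abs_le.2 ⟨by linarith, by linarith⟩
  have hr : ∀ p : PMF (S × A), HasExpect p fun y => M.r y.1 y.2 :=
    fun p => hasExpect_of_bdd fun y _ => M.abs_r_le y
  induction n generalizing e with
  | zero => simp [iter, expect_pure]
  | succ n ih =>
    have h1 : iter (M.rolloutStep π) (n + 1) e =
        (M.next π e.1).bind fun y =>
          iter (M.rolloutStep π) n (y, e.2.1 + M.r y.1 y.2, e.2.2 + 1) := by
      rw [iter, MDP.rolloutStep, PMF.bind_map]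
      rfl
    have hl : ∀ t, HasExpect (M.next π e.1) fun y =>
        expect (M.lawFrom π y (t + 1)) fun y => M.r y.1 y.2 := fun t =>
      hasExpect_of_bdd fun y _ => abs_expect_le fun z _ => M.abs_r_le z
    have hn := hb (n + 1) e
    rw [h1] at hn ⊢
    rw [expect_bind hn]
    simp only [ih]
    rw [expect_add ((hasExpect_const _ _).add (hr _)) (hasExpect_sum _ fun t _ => hl t),
      expect_add (hasExpect_const _ _) (hr _), expect_const, expect_sum _ fun t _ => hl t,
      Finset.sum_range_succ', add_assoc]
    congr 1
    rw [add_comm]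
    congr 1
    · refine Finset.sum_congr rfl fun t _ => ?_
      change _ = expect ((M.next π e.1).bind fun y => M.lawFrom π y (t + 1)) _
      rw [expect_bind (hr _)]
    · change _ = expect ((M.next π e.1).bind fun y => PMF.pure y) _
      rw [PMF.bind_pure]

theorem MDP.lexp_rollout_sq_le (c : (S × A) × ℕ) :
    lexp (M.rollout π c) (fun e => ENNReal.ofReal (e.2.1 ^ 2)) ≤
      ENNReal.ofReal (2 * (1 - M.γ)⁻¹ ^ 2) := by
  rw [MDP.rollout, loop, lexp_bind]
  refine le_trans (lexp_mono _ fun n _ => ?_) (lexp_geom_succ_sq_le M.γ_nonneg M.γ_lt_one)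
  rw [← lexp_const (iter (M.rolloutStep π) n (c.1, M.r c.1.1 c.1.2, c.2 + 1))
    (ENNReal.ofReal (((n : ℝ) + 1) ^ 2))]
  refine lexp_mono _ fun e he => ENNReal.ofReal_le_ofReal ?_
  obtain ⟨h1, h2, -⟩ := M.mem_support_iter_rollout π he
  simp only at h1 h2
  have := M.r_nonneg c.1.1 c.1.2
  have := M.r_le_one c.1.1 c.1.2
  exact pow_le_pow_left₀ (by linarith) (by linarith) 2

theorem HasExpect.of_sq {α : Type*} {p : PMF α} {f : α → ℝ} (h : HasExpect p fun x => f x ^ 2) :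
    HasExpect p f := by
  refine ((hasExpect_const p 1).add h).of_abs_le fun x _ => ?_
  nlinarith [sq_abs (f x), sq_nonneg (|f x| - 1), abs_nonneg (f x)]

theorem MDP.hasExpect_rollout (c : (S × A) × ℕ) :
    HasExpect (M.rollout π c) fun e => e.2.1 :=
  HasExpect.of_sq (HasExpect.of_lexp_le (fun _ => sq_nonneg _) (M.lexp_rollout_sq_le π c))

theorem MDP.expect_rollout (c : (S × A) × ℕ) :
    expect (M.rollout π c) (fun e => e.2.1) = M.Q π c.1 := by
  have h := M.hasExpect_rollout π c
  rw [MDP.rollout, loop] at h ⊢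
  rw [expect_bind h, expect_geom]
  set g : ℕ → ℝ := fun t => expect (M.lawFrom π c.1 t) fun y => M.r y.1 y.2 with hg
  have hgb : ∀ t, |g t| ≤ 1 := fun t => abs_expect_le fun y _ => M.abs_r_le y
  have hg0 : g 0 = M.r c.1.1 c.1.2 := expect_pure _ _
  have hs : Summable fun n : ℕ => ‖M.γ ^ n‖ := by
    simpa only [norm_pow] using summable_geometric_of_lt_one (norm_nonneg M.γ)
      (by rw [Real.norm_eq_abs, abs_of_nonneg M.γ_nonneg]; exact M.γ_lt_one)
  have hs' : Summable fun n : ℕ => ‖M.γ ^ n * g n‖ := by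
    refine Summable.of_nonneg_of_le (fun _ => norm_nonneg _) (fun n => ?_) hs
    rw [norm_mul]
    exact mul_le_of_le_one_right (norm_nonneg _) (hgb n)
  -- The Cauchy product of `∑ γ^k g_k` with the geometric series: the reward at time `k` is
  -- collected exactly when the rollout survives `k` coins, which has probability `γ^k`. The
  -- undiscounted sum is therefore unbiased for the discounted one.
  have hc := tsum_mul_tsum_eq_tsum_sum_range_of_summable_norm hs' hs
  rw [tsum_geometric_of_lt_one M.γ_nonneg M.γ_lt_one] at hc
  have hQ : M.Q π c.1 = ∑' n, M.γ ^ n * g n := rfl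
  have hi : ∀ n, M.γ ^ n * expect (iter (M.rolloutStep π) n (c.1, M.r c.1.1 c.1.2, c.2 + 1))
      (fun e => e.2.1) = ∑ k ∈ Finset.range (n + 1), M.γ ^ k * g k * M.γ ^ (n - k) := by
    intro n
    -- The rollout starts with the reward of time 0 already collected, so `n` further steps give the
    -- `n + 1` terms `g 0, …, g n`.
    rw [M.expect_iter_rollout, ← hg0, add_comm, ← Finset.sum_range_succ' g n, Finset.mul_sum]
    refine Finset.sum_congr rfl fun k hk => ?_
    rw [mul_right_comm, ← pow_add, Nat.add_sub_cancel' (Finset.mem_range_succ_iff.1 hk)]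
  simp only [hi]
  rw [← hc, hQ, mul_comm, mul_assoc, inv_mul_cancel₀ M.one_sub_pos.ne', mul_one]

theorem MDP.lexp_sampler_sq_le (ν : PMF (S × A)) :
    lexp (M.sampler π ν) (fun o => ENNReal.ofReal (o.2.1 ^ 2)) ≤
      ENNReal.ofReal (2 * (1 - M.γ)⁻¹ ^ 2) := by
  simp only [M.sampler_eq, lexp_bind, lexp_map]
  rw [← lexp_const ν (ENNReal.ofReal (2 * (1 - M.γ)⁻¹ ^ 2))]
  refine lexp_mono _ fun x _ => ?_
  rw [← lexp_const (M.search π (x, 1)) (ENNReal.ofReal (2 * (1 - M.γ)⁻¹ ^ 2))]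
  exact lexp_mono _ fun c _ => M.lexp_rollout_sq_le π c

theorem MDP.hasExpect_sampler_sq (ν : PMF (S × A)) :
    HasExpect (M.sampler π ν) fun o => o.2.1 ^ 2 :=
  HasExpect.of_lexp_le (fun _ => sq_nonneg _) (M.lexp_sampler_sq_le π ν)

theorem MDP.expect_sampler_sq_le (ν : PMF (S × A)) :
    expect (M.sampler π ν) (fun o => o.2.1 ^ 2) ≤ 2 * (1 - M.γ)⁻¹ ^ 2 :=
  expect_le_of_lexp_le (fun _ => sq_nonneg _) (by positivity) (M.lexp_sampler_sq_le π ν)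

theorem MDP.sampler_map_fst (ν : PMF (S × A)) :
    (M.sampler π ν).map Prod.fst = M.visitPMF π ν := by
  simp only [M.sampler_eq, PMF.map_bind, PMF.map_comp]
  have h : ∀ c : (S × A) × ℕ, (M.rollout π c).map (Prod.fst ∘ fun e => (c.1, e.2.1, e.2.2)) =
      PMF.pure c.1 := fun c => PMF.map_const _ _
  simp only [h]
  have h' : ∀ x : S × A, ((M.search π (x, 1)).bind fun c => PMF.pure c.1) = M.visitFrom π x :=
    fun x => (PMF.bind_pure_comp _ _).trans (M.search_map_fst π (x, 1))
  simp only [h']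
  rfl

theorem MDP.expect_sampler_fst (ν : PMF (S × A)) {h : S × A → ℝ} {C : ℝ} (hh : ∀ x, |h x| ≤ C) :
    expect (M.sampler π ν) (fun o => h o.1) = expect (M.visitPMF π ν) h := by
  rw [← M.sampler_map_fst, expect_map (hasExpect_of_bdd fun o _ => hh o.1)]

theorem MDP.hasExpect_sampler_mul (ν : PMF (S × A)) {h : S × A → ℝ} {C : ℝ}
    (hh : ∀ x, |h x| ≤ C) : HasExpect (M.sampler π ν) fun o => h o.1 * o.2.1 := by
  refine ((HasExpect.of_sq (M.hasExpect_sampler_sq π ν)).abs.const_mul C).of_abs_le fun o _ => ?_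
  rw [abs_mul]
  exact mul_le_mul_of_nonneg_right (hh _) (abs_nonneg _)

/-- Given the accepted pair, `Q̂` has mean `Q`. Against a bounded function of the pair it may thus
be replaced by `Q`, which makes the SGD gradient unbiased. -/
theorem MDP.expect_sampler_mul (ν : PMF (S × A)) {h : S × A → ℝ} {C : ℝ}
    (hh : ∀ x, |h x| ≤ C) :
    expect (M.sampler π ν) (fun o => h o.1 * o.2.1) =
      expect (M.visitPMF π ν) fun x => h x * M.Q π x := by
  have hs := M.hasExpect_sampler_mul π ν hh
  have hb : ∀ x, |h x * M.Q π x| ≤ C * (1 - M.γ)⁻¹ := fun x => by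
    rw [abs_mul]
    exact mul_le_mul (hh x) (M.abs_Q_le π x) (abs_nonneg _) ((abs_nonneg _).trans (hh x))
  have hi : ∀ c : (S × A) × ℕ, expect ((M.rollout π c).map fun e => (c.1, e.2.1, e.2.2))
      (fun o : (S × A) × ℝ × ℕ => h o.1 * o.2.1) = h c.1 * M.Q π c.1 := by
    intro c
    have hc : HasExpect (M.rollout π c) fun e => h c.1 * e.2.1 :=
      (M.hasExpect_rollout π c).const_mul (h c.1)
    have he := expect_map (g := fun e : (S × A) × ℝ × ℕ => (c.1, e.2.1, e.2.2))
      (f := fun o : (S × A) × ℝ × ℕ => h o.1 * o.2.1) hc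
    rw [he, expect_const_mul (M.rollout π c) (fun e => e.2.1) (h c.1), M.expect_rollout]
  set q : S × A → PMF ((S × A) × ℝ × ℕ) := fun x => (M.search π (x, 1)).bind fun c =>
    (M.rollout π c).map fun e => (c.1, e.2.1, e.2.2) with hq
  have e : M.sampler π ν = ν.bind q := rfl
  rw [e] at hs ⊢
  rw [expect_bind hs, MDP.visitPMF, expect_bind (hasExpect_of_bdd fun x _ => hb x)]
  refine expect_congr fun x hx => ?_
  have hx' := hs.bind_kernel hx
  rw [hq] at hx' ⊢
  rw [expect_bind hx']
  simp only [hi]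
  rw [← M.search_map_fst π (x, 1), expect_map (f := fun x => h x * M.Q π x)
    (hasExpect_of_bdd fun c _ => hb c.1)]

/-- The search uses one sample for the starting pair plus one per success, the rollout one for the
accepted action plus one per success; each has mean `1/(1-γ)`, whatever the policy. -/
theorem MDP.lexp_sampler_count (ν : PMF (S × A)) :
    lexp (M.sampler π ν) (fun o => (o.2.2 : ℝ≥0∞)) = ENNReal.ofReal (2 * (1 - M.γ)⁻¹) := by
  have h2 : ∀ c : (S × A) × ℕ, lexp (M.rollout π c) (fun e => (e.2.2 : ℝ≥0∞)) =
      c.2 + ENNReal.ofReal (1 - M.γ)⁻¹ := by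
    intro c
    rw [MDP.rollout, loop, lexp_bind, ← lexp_geom_succ M.γ_nonneg M.γ_lt_one,
      ← lexp_const (geom M.γ M.γ_nonneg M.γ_lt_one) (c.2 : ℝ≥0∞), ← lexp_add]
    refine lexp_congr _ fun n _ => ?_
    rw [← lexp_const (iter (M.rolloutStep π) n (c.1, M.r c.1.1 c.1.2, c.2 + 1))
      ((c.2 : ℝ≥0∞) + (1 + n))]
    refine lexp_congr _ fun e he => ?_
    rw [(M.mem_support_iter_rollout π he).2.2]
    push_cast
    rw [add_assoc]
  have h1 : ∀ x : S × A, lexp (M.search π (x, 1)) (fun c => (c.2 : ℝ≥0∞)) =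
      ENNReal.ofReal (1 - M.γ)⁻¹ := by
    intro x
    rw [MDP.search, loop, lexp_bind, ← lexp_geom_succ M.γ_nonneg M.γ_lt_one]
    refine lexp_congr _ fun n _ => ?_
    rw [← lexp_const (iter (M.searchStep π) n (x, 1)) (1 + (n : ℝ≥0∞))]
    refine lexp_congr _ fun e he => ?_
    rw [M.mem_support_iter_search π he]
    push_cast
    rfl
  simp only [M.sampler_eq, lexp_bind, lexp_map, h2, lexp_add, h1, lexp_const]
  rw [← ENNReal.ofReal_add (inv_nonneg.2 M.one_sub_pos.le) (inv_nonneg.2 M.one_sub_pos.le),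
    two_mul]

end Sampler

/-! ### Quadratic forms of the features and changes of measure. -/

section Features

variable {S A : Type*} {d : ℕ} (φ : S → A → EuclideanSpace ℝ (Fin d))

/-- The quadratic form `uᵀ Σ_D u` of the feature covariance under the law `D`. -/
noncomputable def quad (D : PMF (S × A)) (u : EuclideanSpace ℝ (Fin d)) : ℝ :=
  expect D fun x => (inner ℝ u (φ x.1 x.2)) ^ 2

variable {φ} {B : ℝ}

theorem abs_inner_feature_le (hφ : ∀ s a, ‖φ s a‖ ≤ B) (u : EuclideanSpace ℝ (Fin d))
    (x : S × A) : |inner ℝ u (φ x.1 x.2)| ≤ ‖u‖ * B :=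
  (abs_real_inner_le_norm _ _).trans (mul_le_mul_of_nonneg_left (hφ _ _) (norm_nonneg _))

theorem sq_inner_feature_le (hφ : ∀ s a, ‖φ s a‖ ≤ B) (u : EuclideanSpace ℝ (Fin d))
    (x : S × A) : |(inner ℝ u (φ x.1 x.2)) ^ 2| ≤ (‖u‖ * B) ^ 2 := by
  rw [abs_pow]
  exact pow_le_pow_left₀ (abs_nonneg _) (abs_inner_feature_le hφ u x) 2

theorem quad_nonneg (D : PMF (S × A)) (u : EuclideanSpace ℝ (Fin d)) : 0 ≤ quad φ D u :=
  expect_nonneg fun _ => sq_nonneg _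

theorem quad_le (hφ : ∀ s a, ‖φ s a‖ ≤ B) (D : PMF (S × A)) (u : EuclideanSpace ℝ (Fin d)) :
    quad φ D u ≤ (‖u‖ * B) ^ 2 :=
  (le_abs_self _).trans (abs_expect_le fun x _ => sq_inner_feature_le hφ u x)

theorem abs_quad_le (hφ : ∀ s a, ‖φ s a‖ ≤ B) (D : PMF (S × A))
    (u : EuclideanSpace ℝ (Fin d)) : |quad φ D u| ≤ (‖u‖ * B) ^ 2 := by
  rw [abs_of_nonneg (quad_nonneg D u)]
  exact quad_le hφ D u

theorem quad_smul (D : PMF (S × A)) (c : ℝ) (u : EuclideanSpace ℝ (Fin d)) :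
    quad φ D (c • u) = c ^ 2 * quad φ D u := by
  simp only [quad, real_inner_smul_left, mul_pow, expect_const_mul]

theorem hasExpect_quad (hφ : ∀ s a, ‖φ s a‖ ≤ B) (D : PMF (S × A))
    (u : EuclideanSpace ℝ (Fin d)) : HasExpect D fun x => (inner ℝ u (φ x.1 x.2)) ^ 2 :=
  hasExpect_of_bdd fun x _ => sq_inner_feature_le hφ u x

/-- Convexity in the form `(a + b)²/(n + 1) ≤ a²/n + b²`, with defect a multiple of `(a - n b)²`.
Iterated, it bounds the quadratic form of an average by the average of the forms. At `n = 0` the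
quotient by `n` is 0 by convention, hence the condition on `u`. -/
theorem quad_add_div_le (hφ : ∀ s a, ‖φ s a‖ ≤ B) (D : PMF (S × A))
    (u v : EuclideanSpace ℝ (Fin d)) (n : ℕ) (hu : n = 0 → u = 0) :
    quad φ D (u + v) / ((n : ℝ) + 1) ≤ quad φ D u / n + quad φ D v := by
  rcases Nat.eq_zero_or_pos n with rfl | hn
  · simp [hu rfl]
  have hn' : (0 : ℝ) < n := by exact_mod_cast hn
  have h : quad φ D (u + v) ≤
      expect D fun x => ((n : ℝ) + 1) / n * (inner ℝ u (φ x.1 x.2)) ^ 2 +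
        ((n : ℝ) + 1) * (inner ℝ v (φ x.1 x.2)) ^ 2 := by
    refine expect_mono (hasExpect_quad hφ D _) (((hasExpect_quad hφ D u).const_mul _).add
      ((hasExpect_quad hφ D v).const_mul _)) fun x _ => ?_
    rw [inner_add_left]
    set a := inner ℝ u (φ x.1 x.2)
    set b := inner ℝ v (φ x.1 x.2)
    have e : ((n : ℝ) + 1) / n * a ^ 2 + ((n : ℝ) + 1) * b ^ 2 - (a + b) ^ 2 =
        (a - n * b) ^ 2 / n := by
      field_simp
      ring
    have : 0 ≤ (a - n * b) ^ 2 / n := by positivity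
    linarith
  rw [expect_add ((hasExpect_quad hφ D u).const_mul _) ((hasExpect_quad hφ D v).const_mul _),
    expect_const_mul, expect_const_mul] at h
  rw [div_le_iff₀ (by positivity)]
  refine h.trans (le_of_eq ?_)
  change _ / _ * quad φ D u + _ * quad φ D v = _
  field_simp

theorem featCov_quad (hφ : ∀ s a, ‖φ s a‖ ≤ B) (D : PMF (S × A)) (w : Fin d → ℝ) :
    dotProduct w (Matrix.mulVec (featCov φ fun x => (D x).toReal) w) =
      quad φ D (WithLp.toLp 2 w) := by
  have hb : ∀ i j, HasExpect D fun x => φ x.1 x.2 i * φ x.1 x.2 j := fun i j =>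
    hasExpect_of_bdd (C := B * B) fun x _ => by
      rw [abs_mul]
      have h : ∀ i, |φ x.1 x.2 i| ≤ B := fun i =>
        (PiLp.norm_apply_le (φ x.1 x.2) i).trans (hφ _ _)
      exact mul_le_mul (h i) (h j) (abs_nonneg _) ((abs_nonneg _).trans (h i))
  have e : (fun x : S × A => (inner ℝ (WithLp.toLp 2 w) (φ x.1 x.2)) ^ 2) =
      fun x => ∑ i, ∑ j, (w i * w j) * (φ x.1 x.2 i * φ x.1 x.2 j) := by
    funext x
    rw [sq, PiLp.inner_apply, Finset.sum_mul_sum]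
    refine Finset.sum_congr rfl fun i _ => Finset.sum_congr rfl fun j _ => ?_
    simp only [RCLike.inner_apply, conj_trivial]
    ring
  rw [quad, e, expect_sum _ fun i _ => hasExpect_sum _ fun j _ => (hb i j).const_mul _]
  refine Finset.sum_congr rfl fun i _ => ?_
  rw [expect_sum _ fun j _ => (hb i j).const_mul _, Matrix.mulVec, dotProduct, Finset.mul_sum]
  refine Finset.sum_congr rfl fun j _ => ?_
  rw [expect_const_mul]
  change w i * (expect D _ * w j) = _
  ring

theorem quad_le_of_relCond (hφ : ∀ s a, ‖φ s a‖ ≤ B) {D D' : PMF (S × A)} {κ : ℝ≥0}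
    (hκ : relCond φ (fun x => (D x).toReal) (fun x => (D' x).toReal) = κ)
    (u : EuclideanSpace ℝ (Fin d)) : quad φ D u ≤ κ * quad φ D' u := by
  have h := le_iSup (fun w : Fin d → ℝ =>
    ENNReal.ofReal (dotProduct w (Matrix.mulVec (featCov φ fun x => (D x).toReal) w)) /
      ENNReal.ofReal (dotProduct w (Matrix.mulVec (featCov φ fun x => (D' x).toReal) w)))
    (WithLp.ofLp u)
  change _ ≤ relCond φ _ _ at h
  rw [hκ] at h
  simp only [featCov_quad hφ] at h
  -- Finiteness of `κ` makes clearing the denominator legitimate even when it vanishes: then the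
  -- numerator must vanish too.
  rw [ENNReal.div_le_iff_le_mul (Or.inr ENNReal.coe_ne_top) (Or.inl ENNReal.ofReal_ne_top),
    ← ENNReal.ofReal_coe_nnreal, ← ENNReal.ofReal_mul κ.coe_nonneg,
    ENNReal.ofReal_le_ofReal_iff (mul_nonneg κ.coe_nonneg (quad_nonneg _ _))] at h
  exact h

/-- The search accepts the starting pair with probability `1 - γ`, so `d_ν^π ≥ (1 - γ) ν`. -/
theorem MDP.quad_le_visit (hφ : ∀ s a, ‖φ s a‖ ≤ B) (M : MDP S A) (π : S → PMF A)
    (ν : PMF (S × A)) (u : EuclideanSpace ℝ (Fin d)) :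
    quad φ ν u ≤ (1 - M.γ)⁻¹ * quad φ (M.visitPMF π ν) u := by
  rw [inv_mul_eq_div, le_div_iff₀ M.one_sub_pos, mul_comm]
  have hb := sq_inner_feature_le hφ u
  rw [quad, quad, MDP.visitPMF, expect_bind (hasExpect_of_bdd fun x _ => hb x),
    ← expect_const_mul]
  refine expect_mono ((hasExpect_quad hφ ν u).const_mul _)
    (hasExpect_of_bdd fun x _ => abs_expect_le fun y _ => hb y) fun x _ => ?_
  rw [MDP.visitFrom, expect_loop _ _ _ hb]
  exact le_add_of_nonneg_right (mul_nonneg M.γ_nonneg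
    (expect_nonneg fun y => expect_nonneg fun z => sq_nonneg _))

/-! ### Projection onto the ball, optimality of the minimizer and one SGD step. -/

theorem norm_projBall_le {W : ℝ} (hW : 0 ≤ W) (w : EuclideanSpace ℝ (Fin d)) :
    ‖projBall W w‖ ≤ W := by
  unfold projBall
  split_ifs with h
  · exact h
  · have hw : 0 < ‖w‖ := hW.trans_lt (not_le.1 h)
    rw [norm_smul, Real.norm_eq_abs, abs_of_nonneg (div_nonneg hW hw.le),
      div_mul_cancel₀ _ hw.ne']

theorem norm_projBall_sub_sq_le {W : ℝ} (hW : 0 ≤ W) {z : EuclideanSpace ℝ (Fin d)}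
    (hz : ‖z‖ ≤ W) (w : EuclideanSpace ℝ (Fin d)) :
    ‖projBall W w - z‖ ^ 2 ≤ ‖w - z‖ ^ 2 := by
  unfold projBall
  split_ifs with h
  · exact le_rfl
  · have h := not_le.1 h
    have hw : 0 < ‖w‖ := hW.trans_lt h
    rw [norm_sub_sq_real, norm_sub_sq_real, norm_smul, real_inner_smul_left, Real.norm_eq_abs,
      abs_of_nonneg (div_nonneg hW hw.le), div_mul_cancel₀ _ hw.ne']
    -- After expansion the claim is `2 (1 - W/‖w‖) ⟨w, z⟩ ≤ ‖w‖² - W²`. Cauchy–Schwarz reduces it to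
    -- `(‖w‖ - W)² ≥ 0`.
    have hi : inner ℝ w z ≤ ‖w‖ * W :=
      (real_inner_le_norm _ _).trans (mul_le_mul_of_nonneg_left hz hw.le)
    have h1 : 0 ≤ 1 - W / ‖w‖ := by
      rw [sub_nonneg, div_le_one hw]
      exact h.le
    have h2 := mul_le_mul_of_nonneg_left hi h1
    have e : W / ‖w‖ * (‖w‖ * W) = W ^ 2 := by field_simp
    nlinarith [sq_nonneg (‖w‖ - W)]

/-- The squared regression error is bounded. -/
theorem abs_residual_le (hφ : ∀ s a, ‖φ s a‖ ≤ B) (M : MDP S A) (π : S → PMF A)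
    (w : EuclideanSpace ℝ (Fin d)) (x : S × A) :
    |M.Q π x - inner ℝ w (φ x.1 x.2)| ≤ (1 - M.γ)⁻¹ + ‖w‖ * B :=
  (abs_sub _ _).trans (add_le_add (M.abs_Q_le π x) (abs_inner_feature_le hφ w x))

theorem sq_residual_le (hφ : ∀ s a, ‖φ s a‖ ≤ B) (M : MDP S A) (π : S → PMF A)
    (w : EuclideanSpace ℝ (Fin d)) (x : S × A) :
    |(M.Q π x - inner ℝ w (φ x.1 x.2)) ^ 2| ≤ ((1 - M.γ)⁻¹ + ‖w‖ * B) ^ 2 := by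
  rw [abs_pow]
  exact pow_le_pow_left₀ (abs_nonneg _) (abs_residual_le hφ M π w x) 2

/-- The regression loss of `w` under the law `D`. -/
noncomputable def sqLoss (φ : S → A → EuclideanSpace ℝ (Fin d)) (M : MDP S A) (π : S → PMF A)
    (D : PMF (S × A)) (w : EuclideanSpace ℝ (Fin d)) : ℝ :=
  expect D fun x => (M.Q π x - inner ℝ w (φ x.1 x.2)) ^ 2

/-- The first-order optimality condition at a minimizer of the regression loss. -/
theorem first_order_optimality (hφ : ∀ s a, ‖φ s a‖ ≤ B) (M : MDP S A) (π : S → PMF A)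
    (D : PMF (S × A)) {W : ℝ} {z w : EuclideanSpace ℝ (Fin d)} (hz : ‖z‖ ≤ W) (hw : ‖w‖ ≤ W)
    (hmin : ∀ v, ‖v‖ ≤ W → sqLoss φ M π D z ≤ sqLoss φ M π D v) :
    0 ≤ expect D fun x =>
      (inner ℝ z (φ x.1 x.2) - M.Q π x) * inner ℝ (w - z) (φ x.1 x.2) := by
  set J := expect D fun x =>
      (inner ℝ z (φ x.1 x.2) - M.Q π x) * inner ℝ (w - z) (φ x.1 x.2) with hJ
  have hJs : HasExpect D fun x =>
      (inner ℝ z (φ x.1 x.2) - M.Q π x) * inner ℝ (w - z) (φ x.1 x.2) :=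
    hasExpect_of_bdd (C := ((1 - M.γ)⁻¹ + ‖z‖ * B) * (‖w - z‖ * B)) fun x _ => by
      have h1 := abs_residual_le hφ M π z x
      rw [abs_mul, abs_sub_comm]
      exact mul_le_mul h1 (abs_inner_feature_le hφ _ x) (abs_nonneg _)
        ((abs_nonneg _).trans h1)
  -- The segment from `z` to `w` stays in the ball, and the loss along it is a quadratic polynomial
  -- in `t`. Dividing its increment by `t` and letting `t → 0` leaves the linear coefficient.
  have key : ∀ t : ℝ, 0 < t → t ≤ 1 → 0 ≤ 2 * J + t * quad φ D (w - z) := by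
    intro t ht ht1
    have hv : ‖z + t • (w - z)‖ ≤ W := by
      have e : z + t • (w - z) = (1 - t) • z + t • w := by
        rw [smul_sub, sub_smul, one_smul]
        abel
      rw [e]
      refine (norm_add_le _ _).trans ?_
      rw [norm_smul, norm_smul, Real.norm_eq_abs, Real.norm_eq_abs, abs_of_pos ht,
        abs_of_nonneg (by linarith)]
      nlinarith
    have h := hmin _ hv
    have e : (fun x : S × A => (M.Q π x - inner ℝ (z + t • (w - z)) (φ x.1 x.2)) ^ 2) =
        fun x => (M.Q π x - inner ℝ z (φ x.1 x.2)) ^ 2 +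
          (2 * t * ((inner ℝ z (φ x.1 x.2) - M.Q π x) * inner ℝ (w - z) (φ x.1 x.2)) +
          t ^ 2 * (inner ℝ (w - z) (φ x.1 x.2)) ^ 2) := by
      funext x
      rw [inner_add_left, real_inner_smul_left]
      ring
    rw [sqLoss, sqLoss, e, expect_add (hasExpect_of_bdd fun x _ => sq_residual_le hφ M π z x)
      ((hJs.const_mul _).add ((hasExpect_quad hφ D _).const_mul _)),
      expect_add (hJs.const_mul _) ((hasExpect_quad hφ D _).const_mul _), expect_const_mul,
      expect_const_mul, ← hJ] at h
    change _ ≤ _ + (_ + t ^ 2 * quad φ D (w - z)) at h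
    have : 0 ≤ t * (2 * J + t * quad φ D (w - z)) := by nlinarith
    exact (mul_nonneg_iff_of_pos_left ht).1 this
  have hlim : Filter.Tendsto (fun t : ℝ => 2 * J + t * quad φ D (w - z))
      (nhdsWithin 0 (Set.Ioi 0)) (nhds (2 * J)) := by
    have : Filter.Tendsto (fun t : ℝ => 2 * J + t * quad φ D (w - z)) (nhds 0)
        (nhds (2 * J + 0 * quad φ D (w - z))) := by
      apply Continuous.tendsto (f := fun t : ℝ => 2 * J + t * quad φ D (w - z))
      fun_prop
    rw [zero_mul, add_zero] at this
    exact this.mono_left nhdsWithin_le_nhds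
  have : 0 ≤ 2 * J := by
    refine ge_of_tendsto hlim ?_
    filter_upwards [Ioc_mem_nhdsGT (zero_lt_one (α := ℝ))] with t ht
    exact key t ht.1 ht.2
  linarith

/-- One step of projected stochastic gradient descent, in expectation. -/
theorem expect_sgd_step_le (hφ : ∀ s a, ‖φ s a‖ ≤ B) (M : MDP S A) (π : S → PMF A)
    (ν : PMF (S × A)) {W α : ℝ} (hW : 0 ≤ W) (hα : 0 ≤ α) (hα1 : 2 * α * B ^ 2 ≤ 1)
    {z w : EuclideanSpace ℝ (Fin d)} (hz : ‖z‖ ≤ W) (hw : ‖w‖ ≤ W)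
    (hmin : ∀ v, ‖v‖ ≤ W → sqLoss φ M π (M.visitPMF π ν) z ≤ sqLoss φ M π (M.visitPMF π ν) v) :
    expect (M.sampler π ν) (fun o => ‖projBall W (w -
        (2 * α * (inner ℝ w (φ o.1.1 o.1.2) - o.2.1)) • φ o.1.1 o.1.2) - z‖ ^ 2) ≤
      ‖w - z‖ ^ 2 - 2 * α * (2 - 2 * α * B ^ 2) * quad φ (M.visitPMF π ν) (w - z) +
        4 * α * (2 * α * B ^ 2) * (1 - M.γ)⁻¹ ^ 2 := by
  set D := M.visitPMF π ν with hD
  set c := 2 * α * B ^ 2 with hc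
  have hc0 : 0 ≤ c := by positivity
  set p : S × A → ℝ := fun x => inner ℝ w (φ x.1 x.2) with hp
  set p' : S × A → ℝ := fun x => inner ℝ (w - z) (φ x.1 x.2) with hp'
  set R := (1 - M.γ)⁻¹ with hR
  have hpb : ∀ x, |p x| ≤ ‖w‖ * B := abs_inner_feature_le hφ w
  have hpb' : ∀ x, |p' x| ≤ ‖w - z‖ * B := abs_inner_feature_le hφ (w - z)
  set b := ‖w‖ * B with hb
  set b' := ‖w - z‖ * B with hb'
  -- The squared step is expanded in powers of `Q̂`: `g0` and `g1` are the coefficients of degree 0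
  -- and 1, and the degree 2 coefficient is `2αc`, where `4α²‖φ‖² ≤ 2αc`.
  set g0 : S × A → ℝ := fun x => -4 * α * (p x * p' x) + 2 * α * c * (p x * p x) with hg0
  set g1 : S × A → ℝ := fun x => 4 * α * p' x - 4 * α * c * p x with hg1
  have hpp' : ∀ x, |p x * p' x| ≤ b * b' := fun x => by
    rw [abs_mul]
    exact mul_le_mul (hpb x) (hpb' x) (abs_nonneg _) ((abs_nonneg _).trans (hpb x))
  have hpp : ∀ x, |p x * p x| ≤ b * b := fun x => by
    rw [abs_mul]
    exact mul_le_mul (hpb x) (hpb x) (abs_nonneg _) ((abs_nonneg _).trans (hpb x))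
  have hg0b : ∀ x, |g0 x| ≤ |-4 * α| * (b * b') + |2 * α * c| * (b * b) := fun x => by
    refine (abs_add_le _ _).trans ?_
    rw [abs_mul (-4 * α), abs_mul (2 * α * c)]
    exact add_le_add (mul_le_mul_of_nonneg_left (hpp' x) (abs_nonneg _))
      (mul_le_mul_of_nonneg_left (hpp x) (abs_nonneg _))
  have hg1b : ∀ x, |g1 x| ≤ |4 * α| * b' + |4 * α * c| * b := fun x => by
    refine (abs_sub _ _).trans ?_
    rw [abs_mul (4 * α), abs_mul (4 * α * c)]
    exact add_le_add (mul_le_mul_of_nonneg_left (hpb' x) (abs_nonneg _))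
      (mul_le_mul_of_nonneg_left (hpb x) (abs_nonneg _))
  have hQ2 := M.hasExpect_sampler_sq π ν
  have s0 : HasExpect (M.sampler π ν) fun o => g0 o.1 := hasExpect_of_bdd fun o _ => hg0b o.1
  have s1 := M.hasExpect_sampler_mul π ν hg1b
  have hstep : expect (M.sampler π ν) (fun o => ‖projBall W (w -
        (2 * α * (inner ℝ w (φ o.1.1 o.1.2) - o.2.1)) • φ o.1.1 o.1.2) - z‖ ^ 2) ≤
      expect (M.sampler π ν) fun o =>
        ‖w - z‖ ^ 2 + (g0 o.1 + (g1 o.1 * o.2.1 + 2 * α * c * o.2.1 ^ 2)) := by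
    refine expect_mono (hasExpect_of_bdd (C := (W + W) ^ 2) fun o _ => ?_)
      ((hasExpect_const _ _).add (s0.add (s1.add (hQ2.const_mul _)))) fun o _ => ?_
    · rw [abs_of_nonneg (sq_nonneg _)]
      exact pow_le_pow_left₀ (norm_nonneg _)
        ((norm_sub_le _ _).trans (add_le_add (norm_projBall_le hW _) hz)) 2
    · refine (norm_projBall_sub_sq_le hW hz _).trans ?_
      rw [sub_right_comm, norm_sub_sq_real, real_inner_smul_right, norm_smul, mul_pow,
        Real.norm_eq_abs, sq_abs]
      have hn : ‖φ o.1.1 o.1.2‖ ^ 2 ≤ B ^ 2 := pow_le_pow_left₀ (norm_nonneg _) (hφ _ _) 2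
      have := mul_le_mul_of_nonneg_left hn (sq_nonneg (2 * α * (p o.1 - o.2.1)))
      change ‖w - z‖ ^ 2 - 2 * (2 * α * (p o.1 - o.2.1) * p' o.1) +
        (2 * α * (p o.1 - o.2.1)) ^ 2 * _ ≤ _
      simp only [hg0, hg1]
      have e : (2 * α * (p o.1 - o.2.1)) ^ 2 * B ^ 2 = 2 * α * c * (p o.1 - o.2.1) ^ 2 := by
        rw [hc]; ring
      rw [e] at this
      nlinarith
  rw [expect_add (hasExpect_const _ _) (s0.add (s1.add (hQ2.const_mul _))), expect_const,
    expect_add s0 (s1.add (hQ2.const_mul _)), expect_add s1 (hQ2.const_mul _),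
    expect_const_mul, M.expect_sampler_fst π ν hg0b, M.expect_sampler_mul π ν hg1b, ← hD] at hstep
  have hsq := M.expect_sampler_sq_le π ν
  have hsq' := mul_le_mul_of_nonneg_left hsq (show 0 ≤ 2 * α * c by positivity)
  have hJ := first_order_optimality hφ M π D hz hw hmin
  -- Comparison with the zero vector gives `L(z) ≤ E Q²`. This absorbs the residual of `z` in the
  -- squared gradient, so that the only noise left is the second moment of `Q̂`.
  have hL := hmin 0 (by simpa using hW)
  have b1 : HasExpect D fun x => (p' x) ^ 2 := hasExpect_quad hφ D _
  have b2 : HasExpect D fun x => (inner ℝ z (φ x.1 x.2) - M.Q π x) * p' x :=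
    hasExpect_of_bdd (C := (R + ‖z‖ * B) * b') fun x _ => by
      have h1 := abs_residual_le hφ M π z x
      rw [abs_mul, abs_sub_comm]
      exact mul_le_mul h1 (hpb' x) (abs_nonneg _) ((abs_nonneg _).trans h1)
  have b3 : ∀ v, HasExpect D fun x => (M.Q π x - inner ℝ v (φ x.1 x.2)) ^ 2 := fun v =>
    hasExpect_of_bdd fun x _ => sq_residual_le hφ M π v x
  have b4 : HasExpect D g0 := hasExpect_of_bdd fun x _ => hg0b x
  have b5 : HasExpect D fun x => g1 x * M.Q π x :=
    hasExpect_of_bdd (C := (|4 * α| * b' + |4 * α * c| * b) * R) fun x _ => by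
      rw [abs_mul]
      exact mul_le_mul (hg1b x) (M.abs_Q_le π x) (abs_nonneg _) ((abs_nonneg _).trans (hg1b x))
  -- With `p = z·φ + p'`, completing squares separates the strict decrease, the first-order term at
  -- `z` and the loss difference to 0. The last two have favourable signs, the former because `c ≤
  -- 1`.
  have hid : expect D g0 + expect D (fun x => g1 x * M.Q π x) =
      -(2 * α * (2 - c)) * quad φ D (w - z) +
        (-(4 * α * (1 - c)) * expect D (fun x => (inner ℝ z (φ x.1 x.2) - M.Q π x) * p' x) +
        2 * α * c * (sqLoss φ M π D z - sqLoss φ M π D 0)) := by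
    rw [← expect_add b4 b5, quad, sqLoss, sqLoss, ← expect_sub (b3 z) (b3 0),
      ← expect_const_mul, ← expect_const_mul, ← expect_const_mul,
      ← expect_add (b2.const_mul _) (((b3 z).sub (b3 0)).const_mul _),
      ← expect_add (b1.const_mul _) ((b2.const_mul _).add (((b3 z).sub (b3 0)).const_mul _))]
    refine expect_congr fun x _ => ?_
    have e : p x = inner ℝ z (φ x.1 x.2) + p' x := by
      rw [hp', hp]
      simp only
      rw [← inner_add_left, add_sub_cancel]
    simp only [hg0, hg1, inner_zero_left]
    rw [e]
    ring
  have h1 : 0 ≤ 4 * α * (1 - c) * expect D fun x =>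
      (inner ℝ z (φ x.1 x.2) - M.Q π x) * p' x :=
    mul_nonneg (mul_nonneg (by linarith) (by linarith)) hJ
  have h2 : 2 * α * c * (sqLoss φ M π D z - sqLoss φ M π D 0) ≤ 0 :=
    mul_nonpos_of_nonneg_of_nonpos (by positivity) (by linarith)
  linarith

end Features

/-! ### Convergence of projected SGD with averaging. -/

section SGD

variable {S A : Type*} [Fintype A] [Nonempty A] {d : ℕ}
  {φ : S → A → EuclideanSpace ℝ (Fin d)} {B : ℝ}

theorem mem_support_sgd (M : MDP S A) (ν : PMF (S × A)) {W : ℝ} (hW : 0 ≤ W) (α : ℝ)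
    (θ : EuclideanSpace ℝ (Fin d)) {n : ℕ}
    {c : EuclideanSpace ℝ (Fin d) × EuclideanSpace ℝ (Fin d) × ℕ}
    (h : c ∈ (sgd φ M ν W α θ n).support) : ‖c.1‖ ≤ W ∧ ‖c.2.1‖ ≤ n * W := by
  induction n generalizing c with
  | zero =>
    rw [sgd, PMF.mem_support_pure_iff] at h
    simp [h, hW]
  | succ n ih =>
    rw [sgd, PMF.mem_support_bind_iff] at h
    obtain ⟨y, hy, h⟩ := h
    rw [PMF.mem_support_map_iff] at h
    obtain ⟨o, -, rfl⟩ := h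
    refine ⟨norm_projBall_le hW _, ?_⟩
    push_cast
    rw [add_mul, one_mul]
    exact (norm_add_le _ _).trans (add_le_add (ih hy).2 (norm_projBall_le hW _))

/-- The potential function in the analysis of projected stochastic gradient descent. -/
noncomputable def sgdPotential (φ : S → A → EuclideanSpace ℝ (Fin d)) (D : PMF (S × A))
    (a : ℝ) (z : EuclideanSpace ℝ (Fin d)) (n : ℕ)
    (c : EuclideanSpace ℝ (Fin d) × EuclideanSpace ℝ (Fin d) × ℕ) : ℝ :=
  a * (quad φ D (c.2.1 - (n : ℝ) • z) / n - quad φ D (c.1 - z)) + ‖c.1 - z‖ ^ 2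

theorem hasExpect_quad_sgd (hφ : ∀ s a, ‖φ s a‖ ≤ B) (M : MDP S A) (ν : PMF (S × A)) {W : ℝ}
    (hW : 0 ≤ W) (hB : 0 ≤ B) (α : ℝ) (θ : EuclideanSpace ℝ (Fin d)) (n : ℕ) (D : PMF (S × A))
    (t : ℝ) (v : EuclideanSpace ℝ (Fin d)) :
    HasExpect (sgd φ M ν W α θ n) fun c => quad φ D (t • c.2.1 - v) := by
  refine hasExpect_of_bdd (C := ((|t| * (n * W) + ‖v‖) * B) ^ 2) fun c hc => ?_
  refine (abs_quad_le hφ D _).trans ?_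
  gcongr
  refine (norm_sub_le _ _).trans ?_
  rw [norm_smul, Real.norm_eq_abs]
  gcongr
  exact (mem_support_sgd M ν hW α θ hc).2

theorem hasExpect_sgdPotential (hφ : ∀ s a, ‖φ s a‖ ≤ B) (M : MDP S A) (ν : PMF (S × A)) {W : ℝ}
    (hW : 0 ≤ W) (hB : 0 ≤ B) (α : ℝ) (θ : EuclideanSpace ℝ (Fin d)) (n : ℕ) (D : PMF (S × A))
    (a : ℝ) (z : EuclideanSpace ℝ (Fin d)) :
    HasExpect (sgd φ M ν W α θ n) (sgdPotential φ D a z n) := by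
  have h1 := (hasExpect_quad_sgd hφ M ν hW hB α θ n D 1 ((n : ℝ) • z)).const_mul (n : ℝ)⁻¹
  have h2 : HasExpect (sgd φ M ν W α θ n) fun c => quad φ D (c.1 - z) := by
    refine hasExpect_of_bdd (C := ((W + ‖z‖) * B) ^ 2) fun c hc => ?_
    refine (abs_quad_le hφ D _).trans ?_
    gcongr
    refine (norm_sub_le _ _).trans ?_
    gcongr
    exact (mem_support_sgd M ν hW α θ hc).1
  have h3 : HasExpect (sgd φ M ν W α θ n) fun c => ‖c.1 - z‖ ^ 2 := by
    refine hasExpect_of_bdd (C := (W + ‖z‖) ^ 2) fun c hc => ?_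
    rw [abs_of_nonneg (sq_nonneg _)]
    gcongr
    refine (norm_sub_le _ _).trans ?_
    gcongr
    exact (mem_support_sgd M ν hW α θ hc).1
  refine (((h1.sub h2).const_mul a).add h3).congr fun c _ => ?_
  rw [one_smul, sgdPotential]
  ring

theorem expect_sgdPotential_le (hφ : ∀ s a, ‖φ s a‖ ≤ B) (M : MDP S A) (ν : PMF (S × A))
    {W α : ℝ} (hW : 0 ≤ W) (hB : 0 ≤ B) (hα : 0 ≤ α) (hα1 : 2 * α * B ^ 2 ≤ 1)
    (θ : EuclideanSpace ℝ (Fin d)) {z : EuclideanSpace ℝ (Fin d)} (hz : ‖z‖ ≤ W)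
    (hmin : ∀ v, ‖v‖ ≤ W → sqLoss φ M (logLinear φ θ) (M.visitPMF (logLinear φ θ) ν) z ≤
      sqLoss φ M (logLinear φ θ) (M.visitPMF (logLinear φ θ) ν) v) (n : ℕ) :
    expect (sgd φ M ν W α θ n) (sgdPotential φ (M.visitPMF (logLinear φ θ) ν)
        (2 * α * (2 - 2 * α * B ^ 2)) z n) ≤
      W ^ 2 + n * (4 * α * (2 * α * B ^ 2) * (1 - M.γ)⁻¹ ^ 2) := by
  set D := M.visitPMF (logLinear φ θ) ν with hD
  set a := 2 * α * (2 - 2 * α * B ^ 2) with ha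
  set K := 4 * α * (2 * α * B ^ 2) * (1 - M.γ)⁻¹ ^ 2 with hK
  have ha0 : 0 ≤ a := mul_nonneg (by linarith) (by linarith)
  induction n with
  | zero =>
    -- At `n = 0` the quotient by zero is 0 and `w_0 = 0`, so the potential is at most `‖z‖²`.
    rw [sgd, expect_pure, sgdPotential]
    simp only [zero_sub, norm_neg, Nat.cast_zero, div_zero, zero_mul, add_zero]
    have h1 := mul_nonneg ha0 (quad_nonneg (φ := φ) D (-z))
    have h2 : ‖z‖ ^ 2 ≤ W ^ 2 := pow_le_pow_left₀ (norm_nonneg _) hz 2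
    linarith
  | succ n ih =>
    have hs := hasExpect_sgdPotential hφ M ν hW hB α θ (n + 1) D a z
    have hs0 := hasExpect_sgdPotential hφ M ν hW hB α θ n D a z
    rw [sgd] at hs ⊢
    rw [expect_bind hs]
    have : expect (sgd φ M ν W α θ n) (fun c => sgdPotential φ D a z n c + K) ≤
        W ^ 2 + ((n + 1 : ℕ) : ℝ) * K := by
      rw [expect_add hs0 (hasExpect_const _ _), expect_const]
      push_cast
      linarith
    refine le_trans (expect_mono hs.bind (hs0.add (hasExpect_const _ _)) fun c hc => ?_) this
    obtain ⟨hc1, hc2⟩ := mem_support_sgd M ν hW α θ hc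
    have hk := hasExpect_map.1 (hs.bind_kernel hc)
    rw [expect_map hk]
    set w' : (S × A) × ℝ × ℕ → EuclideanSpace ℝ (Fin d) := fun o => projBall W (c.1 -
      (2 * α * (inner ℝ c.1 (φ o.1.1 o.1.2) - o.2.1)) • φ o.1.1 o.1.2) with hw'
    have hwb : HasExpect (M.sampler (logLinear φ θ) ν) fun o => ‖w' o - z‖ ^ 2 := by
      refine hasExpect_of_bdd (C := (W + W) ^ 2) fun o _ => ?_
      rw [abs_of_nonneg (sq_nonneg _)]
      gcongr
      exact (norm_sub_le _ _).trans (add_le_add (norm_projBall_le hW _) hz)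
    -- The average runs over `w_1, …, w_n`, whereas the descent step from `w_n` controls the form at
    -- `w_n`, not at `w_{n+1}`. The term `- quad (w_n - z)` in the potential accounts for this
    -- shift.
    refine le_trans (expect_mono hk ((hasExpect_const _ (a * (quad φ D (c.2.1 - (n : ℝ) • z) / n))).add
      hwb) fun o _ => ?_) ?_
    · change a * (quad φ D (c.2.1 + w' o - ((n + 1 : ℕ) : ℝ) • z) / ((n + 1 : ℕ) : ℝ) -
        quad φ D (w' o - z)) + ‖w' o - z‖ ^ 2 ≤ _
      have e : c.2.1 + w' o - ((n + 1 : ℕ) : ℝ) • z = (c.2.1 - (n : ℝ) • z) + (w' o - z) := by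
        push_cast
        rw [add_smul, one_smul]
        abel
      have h := quad_add_div_le hφ D (c.2.1 - (n : ℝ) • z) (w' o - z) n (by
        rintro rfl
        have : ‖c.2.1‖ ≤ 0 := by simpa using hc2
        simp [norm_le_zero_iff.1 this])
      rw [e]
      push_cast
      nlinarith [mul_le_mul_of_nonneg_left h ha0]
    · rw [expect_add (hasExpect_const _ _) hwb, expect_const]
      have := expect_sgd_step_le hφ M (logLinear φ θ) ν hW hα hα1 hz hc1 hmin
      rw [sgdPotential]
      rw [← hD, ← ha, ← hK] at this
      linarith

/-- The excess risk of the averaged iterate, before the learning rate is chosen. -/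
theorem expect_quad_average_le (hφ : ∀ s a, ‖φ s a‖ ≤ B) (M : MDP S A) (ν : PMF (S × A))
    {W α : ℝ} (hW : 0 ≤ W) (hB : 0 ≤ B) (hα : 0 ≤ α) (hα1 : 2 * α * B ^ 2 ≤ 1)
    (θ : EuclideanSpace ℝ (Fin d)) {z : EuclideanSpace ℝ (Fin d)} (hz : ‖z‖ ≤ W)
    (hmin : ∀ v, ‖v‖ ≤ W → sqLoss φ M (logLinear φ θ) (M.visitPMF (logLinear φ θ) ν) z ≤
      sqLoss φ M (logLinear φ θ) (M.visitPMF (logLinear φ θ) ν) v) {N : ℕ} (hN : 0 < N) :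
    2 * α * (2 - 2 * α * B ^ 2) * (N * expect (sgd φ M ν W α θ N) fun c =>
        quad φ (M.visitPMF (logLinear φ θ) ν) ((1 / (N : ℝ)) • c.2.1 - z)) ≤
      W ^ 2 + N * (4 * α * (2 * α * B ^ 2) * (1 - M.γ)⁻¹ ^ 2) := by
  refine le_trans ?_ (expect_sgdPotential_le hφ M ν hW hB hα hα1 θ hz hmin N)
  have hN' : (0 : ℝ) < N := by exact_mod_cast hN
  rw [← expect_const_mul, ← expect_const_mul]
  refine expect_mono (((hasExpect_quad_sgd hφ M ν hW hB α θ N _ _ _).const_mul _).const_mul _)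
    (hasExpect_sgdPotential hφ M ν hW hB α θ N _ _ z) fun c _ => ?_
  set D := M.visitPMF (logLinear φ θ) ν
  set a := 2 * α * (2 - 2 * α * B ^ 2) with ha
  have e : (1 / (N : ℝ)) • c.2.1 - z = (1 / (N : ℝ)) • (c.2.1 - (N : ℝ) • z) := by
    rw [smul_sub, smul_smul, one_div_mul_cancel hN'.ne', one_smul]
  -- The subtracted form at the last iterate is paid for by the remaining squared distance, since `a
  -- B² = c (2 - c) ≤ 1` for `c = 2αB²`.
  have h : a * quad φ D (c.1 - z) ≤ ‖c.1 - z‖ ^ 2 := by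
    have ha0 : 0 ≤ a := mul_nonneg (by linarith) (by linarith)
    refine (mul_le_mul_of_nonneg_left (quad_le hφ D _) ha0).trans ?_
    have : a * B ^ 2 ≤ 1 := by nlinarith [sq_nonneg (1 - 2 * α * B ^ 2)]
    nlinarith [mul_le_mul_of_nonneg_left this (sq_nonneg ‖c.1 - z‖)]
  rw [e, quad_smul, sgdPotential]
  have e2 : (N : ℝ) * ((1 / (N : ℝ)) ^ 2 * quad φ D (c.2.1 - (N : ℝ) • z)) =
      quad φ D (c.2.1 - (N : ℝ) • z) / N := by
    field_simp
  rw [e2]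
  linarith

/-- The excess risk of the averaged iterate at the learning rate of the algorithm. -/
theorem expect_quad_average_le_rate (hφ : ∀ s a, ‖φ s a‖ ≤ B) (M : MDP S A) (ν : PMF (S × A))
    {W α : ℝ} (hW : 0 < W) (hB : 0 < B) {N : ℕ} (hN : 0 < N)
    (hα : α = W / (2 * B * (B * W + 1 / (1 - M.γ)) * Real.sqrt N))
    (θ : EuclideanSpace ℝ (Fin d)) {z : EuclideanSpace ℝ (Fin d)} (hz : ‖z‖ ≤ W)
    (hmin : ∀ v, ‖v‖ ≤ W → sqLoss φ M (logLinear φ θ) (M.visitPMF (logLinear φ θ) ν) z ≤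
      sqLoss φ M (logLinear φ θ) (M.visitPMF (logLinear φ θ) ν) v) :
    expect (sgd φ M ν W α θ N) (fun c =>
        quad φ (M.visitPMF (logLinear φ θ) ν) ((1 / (N : ℝ)) • c.2.1 - z)) ≤
      2 * (B * W) * (B * W + 1) * (1 - M.γ)⁻¹ / Real.sqrt N := by
  set X := expect (sgd φ M ν W α θ N) (fun c =>
        quad φ (M.visitPMF (logLinear φ θ) ν) ((1 / (N : ℝ)) • c.2.1 - z))
  set R := (1 - M.γ)⁻¹ with hR
  set s := Real.sqrt N with hs
  have hN1 : (1 : ℝ) ≤ N := by exact_mod_cast hN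
  have hs1 : 1 ≤ s := Real.one_le_sqrt.2 hN1
  have hsN : (N : ℝ) = s ^ 2 := (Real.sq_sqrt (by linarith)).symm
  have hR1 : 1 ≤ R := (one_le_inv₀ M.one_sub_pos).2 (by linarith [M.γ_nonneg])
  have hx : 0 < B * W := mul_pos hB hW
  set x := B * W with hxdef
  rw [one_div, ← hR] at hα
  -- The learning rate is chosen so that `2αB² = m / √N` with `m ≤ 1`.
  set m := x / (x + R) with hm
  have hxR : 0 < x + R := by linarith
  have hm1 : m ≤ 1 := (div_le_one hxR).2 (by linarith)
  have hm0 : 0 < m := div_pos hx hxR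
  have hα0 : 0 < α := by rw [hα]; positivity
  have hc : 2 * α * B ^ 2 = m / s := by
    rw [hα, hm, hxdef]
    field_simp
  have hcm : m / s ≤ m := div_le_self hm0.le hs1
  have h := expect_quad_average_le hφ M ν hW.le hB.le hα0.le (by rw [hc]; linarith) θ hz hmin hN
  change 2 * α * (2 - 2 * α * B ^ 2) * (N * X) ≤ W ^ 2 + N * (4 * α * (2 * α * B ^ 2) * R ^ 2) at h
  have h2 : m / s * (2 - m / s) * (s ^ 2 * X) ≤ x ^ 2 + 2 * m ^ 2 * R ^ 2 := by
    have := mul_le_mul_of_nonneg_left h (sq_nonneg B)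
    rw [hsN] at this
    have e1 : B ^ 2 * (2 * α * (2 - 2 * α * B ^ 2) * (s ^ 2 * X)) =
        m / s * (2 - m / s) * (s ^ 2 * X) := by rw [← hc]; ring
    have e2 : B ^ 2 * (W ^ 2 + s ^ 2 * (4 * α * (2 * α * B ^ 2) * R ^ 2)) =
        x ^ 2 + 2 * m ^ 2 * R ^ 2 := by
      have : s ^ 2 * (2 * α * B ^ 2) ^ 2 = m ^ 2 := by rw [hc]; field_simp
      rw [hxdef]
      linear_combination 2 * R ^ 2 * this
    rwa [e1, e2] at this
  have h3 : x ^ 2 + 2 * m ^ 2 * R ^ 2 ≤ (2 - m) * (2 * x ^ 2) := by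
    rw [hm]
    have e : (2 - x / (x + R)) * (2 * x ^ 2) - (x ^ 2 + 2 * (x / (x + R)) ^ 2 * R ^ 2) =
        x ^ 2 * (x ^ 2 + 4 * x * R + R ^ 2) / (x + R) ^ 2 := by
      field_simp
      ring
    have : 0 ≤ x ^ 2 * (x ^ 2 + 4 * x * R + R ^ 2) / (x + R) ^ 2 := by positivity
    linarith
  have hmx : m * (x + R) = x := div_mul_cancel₀ _ hxR.ne'
  have h4 : (2 - m / s) * (m * (s * X)) ≤ (2 - m / s) * (m * (2 * x * (x + 1) * R)) := by
    have e : m / s * (2 - m / s) * (s ^ 2 * X) = (2 - m / s) * (m * (s * X)) := by field_simp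
    rw [← e]
    -- Since `x = m (x + R)`, this is `x + R ≤ (x + 1) R`, which uses `R ≥ 1`. Here the factor `BW +
    -- 1` of the theorem arises.
    have h5 : 2 * x ^ 2 ≤ m * (2 * x * (x + 1) * R) := by
      have : x + R ≤ (x + 1) * R := by nlinarith
      have := mul_le_mul_of_nonneg_left this (show 0 ≤ 2 * x * m by positivity)
      nlinarith
    have h6 : (2 - m) * (2 * x ^ 2) ≤ (2 - m / s) * (m * (2 * x * (x + 1) * R)) :=
      mul_le_mul (by linarith) h5 (by positivity) (by linarith)
    linarith
  have h7 := le_of_mul_le_mul_left (le_of_mul_le_mul_left h4 (by linarith)) hm0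
  rw [le_div_iff₀ (by linarith), mul_comm]
  exact h7

theorem lexp_sgd_count (M : MDP S A) (ν : PMF (S × A)) (W α : ℝ)
    (θ : EuclideanSpace ℝ (Fin d)) (n : ℕ) :
    lexp (sgd φ M ν W α θ n) (fun c => (c.2.2 : ℝ≥0∞)) =
      n * ENNReal.ofReal (2 * (1 - M.γ)⁻¹) := by
  induction n with
  | zero => simp [sgd, lexp_pure]
  | succ n ih =>
    simp only [sgd, lexp_bind, lexp_map, Nat.cast_add, lexp_add, lexp_const,
      M.lexp_sampler_count, ih]
    push_cast
    ring

theorem lexp_run_count (M : MDP S A) (ν : PMF (S × A)) (W η α : ℝ) (N t : ℕ) :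
    lexp (run φ M ν W η α N t) (fun o => (o.2 : ℝ≥0∞)) =
      t * (N * ENNReal.ofReal (2 * (1 - M.γ)⁻¹)) := by
  induction t with
  | zero => simp [run, lexp_pure]
  | succ t ih =>
    simp only [run, lexp_bind, lexp_map, Nat.cast_add, lexp_add, lexp_const, lexp_sgd_count, ih]
    push_cast
    ring

end SGD

/-! ### Hoeffding's lemma, log-linear policies and mirror descent. -/

/-- Hoeffding's lemma for a law on a finite type. -/
theorem expect_exp_le {A : Type*} [Fintype A] (p : PMF A) {X : A → ℝ} {b : ℝ}
    (hX : ∀ a, |X a| ≤ b) (t : ℝ) :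
    expect p (fun a => Real.exp (t * X a)) ≤
      Real.exp (t * expect p X + t ^ 2 * b ^ 2 / 2) := by
  let _ : MeasurableSpace A := ⊤
  have hm : Measurable X := measurable_from_top
  have h := (ProbabilityTheory.hasSubgaussianMGF_of_mem_Icc (μ := p.toMeasure) (a := -b) (b := b)
    hm.aemeasurable (Filter.Eventually.of_forall fun a => abs_le.1 (hX a))).mgf_le t
  have hi : ∀ f : A → ℝ, ∫ a, f a ∂p.toMeasure = expect p f := fun f => by
    rw [PMF.integral_eq_sum, expect_eq_sum]
    rfl
  rw [ProbabilityTheory.mgf, hi, hi] at h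
  have e : (fun a => Real.exp (t * (X a - expect p X))) =
      fun a => Real.exp (-(t * expect p X)) * Real.exp (t * X a) := by
    funext a
    rw [← Real.exp_add]
    ring_nf
  have hc : (((‖b - -b‖₊ / 2) ^ 2 : ℝ≥0) : ℝ) = b ^ 2 := by
    push_cast
    rw [Real.norm_eq_abs, div_pow, sq_abs]
    ring
  rw [e, expect_const_mul, hc, Real.exp_neg, inv_mul_le_iff₀ (Real.exp_pos _), ← Real.exp_add] at h
  exact h.trans_eq (congrArg Real.exp (by ring))

section LogLinear

variable {S A : Type*} [Fintype A] [Nonempty A] {d : ℕ}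
  (φ : S → A → EuclideanSpace ℝ (Fin d))

/-- The log-partition function of the log-linear policy. -/
noncomputable def logPartition (θ : EuclideanSpace ℝ (Fin d)) (s : S) : ℝ :=
  Real.log (∑ a, Real.exp (inner ℝ θ (φ s a)))

variable {φ} {B : ℝ}

theorem partition_pos (θ : EuclideanSpace ℝ (Fin d)) (s : S) :
    0 < ∑ a, Real.exp (inner ℝ θ (φ s a)) :=
  Finset.sum_pos (fun _ _ => Real.exp_pos _) Finset.univ_nonempty

theorem logLinear_toReal (θ : EuclideanSpace ℝ (Fin d)) (s : S) (a : A) :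
    (logLinear φ θ s a).toReal =
      Real.exp (inner ℝ θ (φ s a)) / ∑ a', Real.exp (inner ℝ θ (φ s a')) :=
  ENNReal.toReal_ofReal (div_nonneg (Real.exp_pos _).le (partition_pos θ s).le)

theorem le_logPartition (θ : EuclideanSpace ℝ (Fin d)) (s : S) (a : A) :
    inner ℝ θ (φ s a) ≤ logPartition φ θ s := by
  rw [logPartition, Real.le_log_iff_exp_le (partition_pos θ s)]
  exact Finset.single_le_sum (f := fun a => Real.exp (inner ℝ θ (φ s a)))
    (fun a _ => (Real.exp_pos _).le) (Finset.mem_univ a)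

theorem logPartition_le (hφ : ∀ s a, ‖φ s a‖ ≤ B) (θ : EuclideanSpace ℝ (Fin d)) (s : S) :
    logPartition φ θ s ≤ Real.log (Fintype.card A) + ‖θ‖ * B := by
  have hc : (0 : ℝ) < Fintype.card A := by exact_mod_cast Fintype.card_pos
  rw [logPartition, Real.log_le_iff_le_exp (partition_pos θ s), Real.exp_add, Real.exp_log hc]
  refine (Finset.sum_le_card_nsmul Finset.univ _ (Real.exp (‖θ‖ * B)) fun a _ => ?_).trans_eq ?_
  · exact Real.exp_le_exp.2 ((le_abs_self _).trans (abs_inner_feature_le hφ θ (s, a)))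
  · rw [nsmul_eq_mul, Finset.card_univ]

/-- The increment of the log-partition function is the cumulant generating function of `w·φ` under
`π_θ`, to which Hoeffding's lemma applies with range `[-BW, BW]`. -/
theorem logPartition_add_le (hφ : ∀ s a, ‖φ s a‖ ≤ B) (hB : 0 ≤ B)
    (θ w : EuclideanSpace ℝ (Fin d)) {W : ℝ} (hw : ‖w‖ ≤ W) (η : ℝ) (s : S) :
    logPartition φ (θ + η • w) s ≤ logPartition φ θ s +
      η * expect (logLinear φ θ s) (fun a => inner ℝ w (φ s a)) + η ^ 2 * (B * W) ^ 2 / 2 := by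
  have hX : ∀ a, |inner ℝ w (φ s a)| ≤ B * W := fun a => by
    refine (abs_inner_feature_le hφ w (s, a)).trans ?_
    rw [mul_comm]
    exact mul_le_mul_of_nonneg_left hw hB
  have h := expect_exp_le (logLinear φ θ s) hX η
  have hZ := partition_pos (φ := φ) θ s
  have e : ∑ a, Real.exp (inner ℝ (θ + η • w) (φ s a)) =
      (∑ a, Real.exp (inner ℝ θ (φ s a))) *
        expect (logLinear φ θ s) fun a => Real.exp (η * inner ℝ w (φ s a)) := by
    rw [expect_eq_sum, Finset.mul_sum]
    refine Finset.sum_congr rfl fun a _ => ?_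
    rw [logLinear_toReal, ← mul_assoc, mul_div_cancel₀ _ hZ.ne', ← Real.exp_add, inner_add_left,
      real_inner_smul_left]
  rw [logPartition, Real.log_le_iff_le_exp (partition_pos _ s), e, add_assoc, Real.exp_add,
    logPartition, Real.exp_log hZ]
  exact mul_le_mul_of_nonneg_left h hZ.le

/-- The expected cross entropy of the log-linear policy relative to `π`. -/
noncomputable def crossEntropy (φ : S → A → EuclideanSpace ℝ (Fin d)) (D : PMF S)
    (π : S → PMF A) (θ : EuclideanSpace ℝ (Fin d)) : ℝ :=
  expect (joint D π) fun x => logPartition φ θ x.1 - inner ℝ θ (φ x.1 x.2)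

theorem abs_neg_log_policy_le (hφ : ∀ s a, ‖φ s a‖ ≤ B) (θ : EuclideanSpace ℝ (Fin d))
    (x : S × A) : |logPartition φ θ x.1 - inner ℝ θ (φ x.1 x.2)| ≤
      Real.log (Fintype.card A) + 2 * (‖θ‖ * B) := by
  rw [abs_of_nonneg (sub_nonneg.2 (le_logPartition θ x.1 x.2))]
  linarith [logPartition_le hφ θ x.1, (abs_le.1 (abs_inner_feature_le hφ θ x)).1]

/-- Action probabilities are at most 1, so `-log π_θ ≥ 0`. The cross entropy differs from the
relative entropy by a quantity independent of `θ`, and so serves equally well as a potential. -/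
theorem crossEntropy_nonneg (D : PMF S) (π : S → PMF A) (θ : EuclideanSpace ℝ (Fin d)) :
    0 ≤ crossEntropy φ D π θ :=
  expect_nonneg fun x => sub_nonneg.2 (le_logPartition θ x.1 x.2)

theorem crossEntropy_le (hφ : ∀ s a, ‖φ s a‖ ≤ B) (D : PMF S) (π : S → PMF A)
    (θ : EuclideanSpace ℝ (Fin d)) :
    |crossEntropy φ D π θ| ≤ Real.log (Fintype.card A) + 2 * (‖θ‖ * B) :=
  abs_expect_le fun x _ => abs_neg_log_policy_le hφ θ x

/-- One step of mirror descent decreases the cross entropy. -/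
theorem mirror_descent_step (hφ : ∀ s a, ‖φ s a‖ ≤ B) (hB : 0 ≤ B) (D : PMF S) (π : S → PMF A)
    (θ w : EuclideanSpace ℝ (Fin d)) {W : ℝ} (hw : ‖w‖ ≤ W) (η : ℝ) :
    η * (expect (joint D π) (fun x => inner ℝ w (φ x.1 x.2)) -
        expect (joint D (logLinear φ θ)) (fun x => inner ℝ w (φ x.1 x.2))) ≤
      crossEntropy φ D π θ - crossEntropy φ D π (θ + η • w) + η ^ 2 * (B * W) ^ 2 / 2 := by
  set g : S → ℝ := fun s => expect (logLinear φ θ s) fun a => inner ℝ w (φ s a) with hg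
  have hgb : ∀ s, |g s| ≤ ‖w‖ * B := fun s =>
    abs_expect_le fun a _ => abs_inner_feature_le hφ w (s, a)
  have b1 : HasExpect (joint D π) fun x => logPartition φ θ x.1 - inner ℝ θ (φ x.1 x.2) :=
    hasExpect_of_bdd fun x _ => abs_neg_log_policy_le hφ θ x
  have b2 : HasExpect (joint D π) fun x => g x.1 := hasExpect_of_bdd fun x _ => hgb x.1
  have b3 : HasExpect (joint D π) fun x => inner ℝ w (φ x.1 x.2) :=
    hasExpect_of_bdd fun x _ => abs_inner_feature_le hφ w x
  have h : crossEntropy φ D π (θ + η • w) ≤ expect (joint D π) fun x =>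
      (logPartition φ θ x.1 - inner ℝ θ (φ x.1 x.2)) +
        (η * (g x.1 - inner ℝ w (φ x.1 x.2)) + η ^ 2 * (B * W) ^ 2 / 2) := by
    refine expect_mono (hasExpect_of_bdd fun x _ => abs_neg_log_policy_le hφ _ x)
      (b1.add (((b2.sub b3).const_mul _).add (hasExpect_const _ _))) fun x _ => ?_
    have := logPartition_add_le hφ hB θ w hw η x.1
    rw [inner_add_left, real_inner_smul_left]
    change _ ≤ _ + η * g x.1 + _ at this
    linarith
  rw [expect_add b1 (((b2.sub b3).const_mul _).add (hasExpect_const _ _)),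
    expect_add ((b2.sub b3).const_mul _) (hasExpect_const _ _), expect_const, expect_const_mul,
    expect_sub b2 b3, expect_joint fun x => hgb x.1] at h
  simp only [expect_const] at h
  rw [expect_joint (π := logLinear φ θ) (abs_inner_feature_le hφ w)]
  change _ ≤ crossEntropy φ D π θ + _ at h
  change η * (_ - expect D g) ≤ _
  change _ ≤ _ + (η * (expect D g - _) + _) at h
  linarith

/-- Jensen, followed by the bound `|A|` for the density of any policy with respect to the uniform
one. -/
theorem expect_joint_sq_le (D : PMF S) (π : S → PMF A) {f : S × A → ℝ} {C : ℝ}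
    (hf : ∀ x, |f x| ≤ C) :
    |expect (joint D π) f| ≤ Real.sqrt (Fintype.card A *
      expect (joint D fun _ => PMF.uniformOfFintype A) fun x => f x ^ 2) := by
  have hf2 : ∀ x, |f x ^ 2| ≤ C ^ 2 := fun x => by
    rw [abs_pow]
    exact pow_le_pow_left₀ (abs_nonneg _) (hf x) 2
  have hc : (Fintype.card A : ℝ) ≠ 0 := by exact_mod_cast Fintype.card_ne_zero
  refine Real.abs_le_sqrt ((expect_sq_le (hasExpect_of_bdd fun x _ => hf x)
    (hasExpect_of_bdd fun x _ => hf2 x)).trans ?_)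
  rw [expect_joint hf2, expect_joint hf2, ← expect_const_mul]
  have hb : ∀ p : S → PMF A, HasExpect D fun s => expect (p s) fun a => f (s, a) ^ 2 :=
    fun p => hasExpect_of_bdd fun s _ => abs_expect_le fun a _ => hf2 (s, a)
  refine expect_mono (hb _) ((hb _).const_mul _) fun s _ => ?_
  rw [expect_eq_sum, expect_eq_sum, Finset.mul_sum]
  refine Finset.sum_le_sum fun a _ => ?_
  have h1 : (π s a).toReal ≤ 1 :=
    ENNReal.toReal_le_of_le_ofReal zero_le_one (by simpa using (π s).coe_le_one a)
  rw [PMF.uniformOfFintype_apply, ENNReal.toReal_inv, ENNReal.toReal_natCast,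
    mul_inv_cancel_left₀ hc]
  exact mul_le_of_le_one_left (sq_nonneg _) h1

/-- One outer iteration: the suboptimality is controlled by the decrease of the cross entropy, the
bias of the regression target and the statistical error of the regression. -/
theorem suboptimality_step (hφ : ∀ s a, ‖φ s a‖ ≤ B) (hB : 0 ≤ B) (M : MDP S A) (ρ : PMF S)
    (π : S → PMF A) (θ w z : EuclideanSpace ℝ (Fin d)) {W η : ℝ} (hw : ‖w‖ ≤ W) (hη : 0 ≤ η) :
    η * (M.value π ρ - M.value (logLinear φ θ) ρ) ≤
      (1 - M.γ)⁻¹ * (crossEntropy φ (M.stateVisitPMF π ρ) π θ -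
        crossEntropy φ (M.stateVisitPMF π ρ) π (θ + η • w) + η ^ 2 * (B * W) ^ 2 / 2 +
      η * (2 * Real.sqrt (Fintype.card A * sqLoss φ M (logLinear φ θ)
          (joint (M.stateVisitPMF π ρ) fun _ => PMF.uniformOfFintype A) z) +
        2 * Real.sqrt (Fintype.card A *
          quad φ (joint (M.stateVisitPMF π ρ) fun _ => PMF.uniformOfFintype A) (w - z)))) := by
  set D := M.stateVisitPMF π ρ
  set π' := logLinear φ θ
  -- The split into linear part, bias and statistical error, applied below to the comparator and to
  -- the current policy.
  have hQ : ∀ p : PMF (S × A), expect p (M.Q π') =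
      expect p (fun x => inner ℝ w (φ x.1 x.2)) +
        (expect p (fun x => M.Q π' x - inner ℝ z (φ x.1 x.2)) -
          expect p (fun x => inner ℝ (w - z) (φ x.1 x.2))) := by
    intro p
    have b1 : ∀ v, HasExpect p fun x => inner ℝ v (φ x.1 x.2) := fun v =>
      hasExpect_of_bdd fun x _ => abs_inner_feature_le hφ v x
    have b2 : HasExpect p fun x => M.Q π' x - inner ℝ z (φ x.1 x.2) :=
      hasExpect_of_bdd fun x _ => abs_residual_le hφ M π' z x
    rw [← expect_sub b2 (b1 _), ← expect_add (b1 w) (b2.sub (b1 _))]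
    refine expect_congr fun x _ => ?_
    rw [inner_sub_left]
    ring
  have hb : ∀ p : S → PMF A, HasExpect D fun s => expect (p s) fun a => M.Q π' (s, a) :=
    fun p => hasExpect_of_bdd fun s _ => abs_expect_le fun a _ => M.abs_Q_le π' (s, a)
  rw [M.performance_difference π' π ρ, expect_sub (hb _) (hb _),
    ← expect_joint (M.abs_Q_le π'), ← expect_joint (M.abs_Q_le π'), hQ, hQ, mul_left_comm]
  refine mul_le_mul_of_nonneg_left ?_ (inv_nonneg.2 M.one_sub_pos.le)
  have h0 := mirror_descent_step hφ hB D π θ w hw η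
  have e1 := fun p : S → PMF A => abs_le.1 (expect_joint_sq_le D p (abs_residual_le hφ M π' z))
  have e2 := fun p : S → PMF A => abs_le.1 (expect_joint_sq_le D p (abs_inner_feature_le hφ (w - z)))
  have h1 := e1 π
  have h2 := e1 π'
  have h3 := e2 π
  have h4 := e2 π'
  change -Real.sqrt (_ * sqLoss φ M π' _ z) ≤ _ ∧ _ ≤ Real.sqrt (_ * sqLoss φ M π' _ z) at h1 h2
  change -Real.sqrt (_ * quad φ _ (w - z)) ≤ _ ∧ _ ≤ Real.sqrt (_ * quad φ _ (w - z)) at h3 h4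
  have h5 : η * ((expect (joint D π) (fun x => M.Q π' x - inner ℝ z (φ x.1 x.2)) -
      expect (joint D π) (fun x => inner ℝ (w - z) (φ x.1 x.2))) -
      (expect (joint D π') (fun x => M.Q π' x - inner ℝ z (φ x.1 x.2)) -
      expect (joint D π') (fun x => inner ℝ (w - z) (φ x.1 x.2)))) ≤
      η * (2 * Real.sqrt (Fintype.card A * sqLoss φ M π'
          (joint D fun _ => PMF.uniformOfFintype A) z) +
        2 * Real.sqrt (Fintype.card A *
          quad φ (joint D fun _ => PMF.uniformOfFintype A) (w - z))) :=
    mul_le_mul_of_nonneg_left (by linarith [h1.2, h2.1, h3.1, h4.2]) hη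
  linarith

end LogLinear

theorem crossEntropy_zero {S A : Type*} [Fintype A] {d : ℕ}
    (φ : S → A → EuclideanSpace ℝ (Fin d)) (D : PMF S) (π : S → PMF A) :
    crossEntropy φ D π 0 = Real.log (Fintype.card A) := by
  simp [crossEntropy, logPartition, expect_const]

/-! ### The outer iteration and its summation. -/

section Run

variable {S A : Type*} [Fintype A] [Nonempty A] {d : ℕ}
  {φ : S → A → EuclideanSpace ℝ (Fin d)} {B : ℝ}

theorem norm_average_le {W : ℝ} {N : ℕ} (hN : 0 < N) {σ : EuclideanSpace ℝ (Fin d)}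
    (h : ‖σ‖ ≤ N * W) : ‖(1 / (N : ℝ)) • σ‖ ≤ W := by
  have hN' : (0 : ℝ) < N := by exact_mod_cast hN
  rw [norm_smul, Real.norm_eq_abs, abs_of_pos (by positivity), one_div_mul_eq_div,
    div_le_iff₀ hN', mul_comm]
  exact h

theorem mem_support_run (M : MDP S A) (ν : PMF (S × A)) {W η : ℝ} (hW : 0 ≤ W) (hη : 0 ≤ η)
    (α : ℝ) {N : ℕ} (hN : 0 < N) {t : ℕ} {o : (ℕ → EuclideanSpace ℝ (Fin d)) × ℕ}
    (h : o ∈ (run φ M ν W η α N t).support) (k : ℕ) : ‖o.1 k‖ ≤ t * (η * W) := by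
  induction t generalizing o k with
  | zero =>
    rw [run, PMF.mem_support_pure_iff] at h
    simp [h]
  | succ t ih =>
    rw [run, PMF.mem_support_bind_iff] at h
    obtain ⟨y, hy, h⟩ := h
    rw [PMF.mem_support_map_iff] at h
    obtain ⟨c, hc, rfl⟩ := h
    have hy' : ∀ k, ‖y.1 k‖ ≤ t * (η * W) := ih hy
    have hηW := mul_nonneg hη hW
    push_cast
    simp only [Function.update_apply]
    split_ifs
    · rw [add_mul, one_mul]
      refine (norm_add_le _ _).trans (add_le_add (hy' t) ?_)
      rw [norm_smul, Real.norm_eq_abs, abs_of_nonneg hη]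
      exact mul_le_mul_of_nonneg_left
        (norm_average_le hN (mem_support_sgd M ν hW α _ hc).2) hη
    · linarith [hy' k]

theorem MDP.abs_value_le {S A : Type*} (M : MDP S A) (π : S → PMF A) (ρ : PMF S) :
    |M.value π ρ| ≤ (1 - M.γ)⁻¹ :=
  abs_expect_le fun s _ => M.abs_V_le π s

theorem sqLoss_nonneg {S A : Type*} (φ : S → A → EuclideanSpace ℝ (Fin d)) (M : MDP S A)
    (π : S → PMF A) (D : PMF (S × A)) (w : EuclideanSpace ℝ (Fin d)) : 0 ≤ sqLoss φ M π D w :=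
  expect_nonneg fun _ => sq_nonneg _

theorem abs_sqLoss_le {S A : Type*} {φ : S → A → EuclideanSpace ℝ (Fin d)}
    (hφ : ∀ s a, ‖φ s a‖ ≤ B) (hB : 0 ≤ B) (M : MDP S A)
    (π : S → PMF A) (D : PMF (S × A)) {w : EuclideanSpace ℝ (Fin d)} {W : ℝ} (hw : ‖w‖ ≤ W) :
    |sqLoss φ M π D w| ≤ ((1 - M.γ)⁻¹ + W * B) ^ 2 := by
  refine abs_expect_le fun x _ => (sq_residual_le hφ M π w x).trans ?_
  have := inv_nonneg.2 M.one_sub_pos.le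
  gcongr

/-- The suboptimality of a log-linear policy. -/
noncomputable def gap (φ : S → A → EuclideanSpace ℝ (Fin d)) (M : MDP S A) (π : S → PMF A)
    (ρ : PMF S) (θ : EuclideanSpace ℝ (Fin d)) : ℝ :=
  M.value π ρ - M.value (logLinear φ θ) ρ

theorem abs_gap_le (M : MDP S A) (π : S → PMF A) (ρ : PMF S) (θ : EuclideanSpace ℝ (Fin d)) :
    |gap φ M π ρ θ| ≤ (1 - M.γ)⁻¹ + (1 - M.γ)⁻¹ :=
  (abs_sub _ _).trans (add_le_add (M.abs_value_le _ _) (M.abs_value_le _ _))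

/-- The square root of the scaled bias of the regression target `z` at the policy parameter `θ`. -/
noncomputable def biasTerm (φ : S → A → EuclideanSpace ℝ (Fin d)) (M : MDP S A) (π : S → PMF A)
    (ρ : PMF S) (θ z : EuclideanSpace ℝ (Fin d)) : ℝ :=
  Real.sqrt (Fintype.card A * sqLoss φ M (logLinear φ θ)
    (joint (M.stateVisitPMF π ρ) fun _ => PMF.uniformOfFintype A) z)

theorem abs_biasTerm_le (hφ : ∀ s a, ‖φ s a‖ ≤ B) (hB : 0 ≤ B) (M : MDP S A) (π : S → PMF A)
    (ρ : PMF S) (θ : EuclideanSpace ℝ (Fin d)) {z : EuclideanSpace ℝ (Fin d)} {W : ℝ}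
    (hz : ‖z‖ ≤ W) : |biasTerm φ M π ρ θ z| ≤
      Real.sqrt (Fintype.card A * ((1 - M.γ)⁻¹ + W * B) ^ 2) := by
  rw [biasTerm, abs_of_nonneg (Real.sqrt_nonneg _)]
  refine Real.sqrt_le_sqrt (mul_le_mul_of_nonneg_left ?_ (Nat.cast_nonneg _))
  exact (le_abs_self _).trans (abs_sqLoss_le hφ hB M _ _ hz)

/-- One outer iteration in expectation. -/
theorem expect_crossEntropy_step (hφ : ∀ s a, ‖φ s a‖ ≤ B) (M : MDP S A) (ρ : PMF S)
    (ν : PMF (S × A)) (π : S → PMF A) {W η α : ℝ} (hW : 0 < W) (hB : 0 < B) (hη : 0 ≤ η)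
    {N : ℕ} (hN : 0 < N)
    (hα : α = W / (2 * B * (B * W + 1 / (1 - M.γ)) * Real.sqrt N)) {κ : ℝ≥0}
    (hκ : relCond φ (M.dStar π ρ) (fun x => (ν x).toReal) = κ)
    (θ : EuclideanSpace ℝ (Fin d)) {z : EuclideanSpace ℝ (Fin d)} (hz : ‖z‖ ≤ W)
    (hmin : ∀ v, ‖v‖ ≤ W → sqLoss φ M (logLinear φ θ) (M.visitPMF (logLinear φ θ) ν) z ≤
      sqLoss φ M (logLinear φ θ) (M.visitPMF (logLinear φ θ) ν) v) :
    expect (sgd φ M ν W α θ N) (fun c => (1 - M.γ)⁻¹ * crossEntropy φ (M.stateVisitPMF π ρ) π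
        (θ + η • ((1 / (N : ℝ)) • c.2.1))) ≤
      (1 - M.γ)⁻¹ * crossEntropy φ (M.stateVisitPMF π ρ) π θ - η * gap φ M π ρ θ +
        (1 - M.γ)⁻¹ * (η ^ 2 * (B * W) ^ 2 / 2) +
        η * (2 * (1 - M.γ)⁻¹ * biasTerm φ M π ρ θ z) +
        η * (2 * (1 - M.γ)⁻¹ * Real.sqrt (Fintype.card A * (κ * ((1 - M.γ)⁻¹ *
          (2 * (B * W) * (B * W + 1) * (1 - M.γ)⁻¹ / Real.sqrt N))))) := by
  set R := (1 - M.γ)⁻¹ with hR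
  have hR0 : 0 ≤ R := inv_nonneg.2 M.one_sub_pos.le
  set D := M.stateVisitPMF π ρ with hD
  set U := joint D fun _ => PMF.uniformOfFintype A with hU
  set ε := 2 * (B * W) * (B * W + 1) * R / Real.sqrt N with hε
  have hdS : M.dStar π ρ = fun x => (U x).toReal := funext (M.dStar_eq π ρ)
  rw [hdS] at hκ
  set P := sgd φ M ν W α θ N with hP
  have hq : ∀ D' : PMF (S × A), HasExpect P fun c => quad φ D' ((1 / (N : ℝ)) • c.2.1 - z) :=
    fun D' => hasExpect_quad_sgd hφ M ν hW.le hB.le α θ N D' (1 / (N : ℝ)) z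
  have hcard : (0 : ℝ) ≤ Fintype.card A := Nat.cast_nonneg _
  have hs0 : ∀ c : EuclideanSpace ℝ (Fin d) × EuclideanSpace ℝ (Fin d) × ℕ,
      0 ≤ Fintype.card A * quad φ U ((1 / (N : ℝ)) • c.2.1 - z) :=
    fun c => mul_nonneg hcard (quad_nonneg _ _)
  have hsq : expect P (fun c => Real.sqrt (Fintype.card A *
      quad φ U ((1 / (N : ℝ)) • c.2.1 - z))) ≤ Real.sqrt (Fintype.card A * (κ * (R * ε))) := by
    refine (expect_sqrt_le ((hq _).const_mul _) hs0).trans (Real.sqrt_le_sqrt ?_)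
    rw [expect_const_mul]
    refine mul_le_mul_of_nonneg_left ?_ hcard
    have h1 := expect_quad_average_le_rate hφ M ν hW hB hN hα θ hz hmin
    -- The change of measure from `d⋆` to `ν` to `d_ν^π`, at cost `κ` and then `1/(1-γ)`, holds for
    -- each realized `w`.
    have h2 : expect P (fun c => quad φ U ((1 / (N : ℝ)) • c.2.1 - z)) ≤
        expect P (fun c => κ * (R * quad φ (M.visitPMF (logLinear φ θ) ν)
          ((1 / (N : ℝ)) • c.2.1 - z))) :=
      expect_mono (hq _) (((hq _).const_mul _).const_mul _) fun c _ =>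
        (quad_le_of_relCond hφ hκ _).trans
          (mul_le_mul_of_nonneg_left (M.quad_le_visit hφ _ ν _) κ.coe_nonneg)
    rw [expect_const_mul, expect_const_mul] at h2
    exact h2.trans (mul_le_mul_of_nonneg_left (mul_le_mul_of_nonneg_left h1 hR0) κ.coe_nonneg)
  set K := R * crossEntropy φ D π θ - η * gap φ M π ρ θ + R * (η ^ 2 * (B * W) ^ 2 / 2) +
        η * (2 * R * biasTerm φ M π ρ θ z) with hK
  have hstep : expect P (fun c => R * crossEntropy φ D π (θ + η • ((1 / (N : ℝ)) • c.2.1))) ≤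
      expect P (fun c => K + η * (2 * R) * Real.sqrt (Fintype.card A *
        quad φ U ((1 / (N : ℝ)) • c.2.1 - z))) := by
    refine expect_mono ?_ ((hasExpect_const _ _).add ((((hq _).const_mul _).sqrt hs0).const_mul _))
      fun c hc => ?_
    · refine HasExpect.const_mul (hasExpect_of_bdd
        (C := Real.log (Fintype.card A) + 2 * ((‖θ‖ + η * W) * B)) fun c hc => ?_) _
      refine (crossEntropy_le hφ D π _).trans ?_
      gcongr
      refine (norm_add_le _ _).trans ?_
      rw [norm_smul, Real.norm_eq_abs, abs_of_nonneg hη]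
      gcongr
      exact norm_average_le hN (mem_support_sgd M ν hW.le α _ hc).2
    · have h := suboptimality_step hφ hB.le M ρ π θ ((1 / (N : ℝ)) • c.2.1) z
        (norm_average_le hN (mem_support_sgd M ν hW.le α _ hc).2) hη
      change η * gap φ M π ρ θ ≤ R * (_ - _ + _ + η * (2 * biasTerm φ M π ρ θ z + _)) at h
      rw [← hD, ← hU] at h
      linarith
  rw [expect_add (hasExpect_const _ _) ((((hq _).const_mul _).sqrt hs0).const_mul _),
    expect_const, expect_const_mul P (fun c => Real.sqrt (Fintype.card A *
      quad φ U ((1 / (N : ℝ)) • c.2.1 - z)))] at hstep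
  have := mul_le_mul_of_nonneg_left hsq (show 0 ≤ η * (2 * R) by positivity)
  linarith

theorem hasExpect_run_potential (M : MDP S A) (ν : PMF (S × A)) {W η : ℝ} (hW : 0 ≤ W)
    (hη : 0 ≤ η) (α : ℝ) {N : ℕ} (hN : 0 < N) {G : ℕ → EuclideanSpace ℝ (Fin d) → ℝ}
    {F : EuclideanSpace ℝ (Fin d) → ℝ} {C a b : ℝ} {t : ℕ} (hb : 0 ≤ b)
    (hG : ∀ k < t, ∀ θ, |G k θ| ≤ C) (hF : ∀ θ, |F θ| ≤ a + b * ‖θ‖) :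
    HasExpect (run φ M ν W η α N t) fun o => ∑ k ∈ Finset.range t, G k (o.1 k) + F (o.1 t) := by
  refine (hasExpect_sum _ fun k hk => hasExpect_of_bdd fun o _ =>
    hG k (Finset.mem_range.1 hk) (o.1 k)).add
    (hasExpect_of_bdd (C := a + b * (t * (η * W))) fun o ho => (hF _).trans ?_)
  gcongr
  exact mem_support_run M ν hW hη α hN ho t

/-- A potential `F` that decreases by `G t` in every outer iteration bounds the sum of the `G t`. -/
theorem expect_run_potential_le (M : MDP S A) (ν : PMF (S × A)) {W η : ℝ} (hW : 0 ≤ W)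
    (hη : 0 ≤ η) (α : ℝ) {N T : ℕ} (hN : 0 < N) {G : ℕ → EuclideanSpace ℝ (Fin d) → ℝ}
    {F : EuclideanSpace ℝ (Fin d) → ℝ} {C a b : ℝ} (hb : 0 ≤ b)
    (hG : ∀ k < T, ∀ θ, |G k θ| ≤ C) (hF : ∀ θ, |F θ| ≤ a + b * ‖θ‖)
    (hstep : ∀ t < T, ∀ θ, expect (sgd φ M ν W α θ N)
      (fun c => F (θ + η • ((1 / (N : ℝ)) • c.2.1))) ≤ F θ - G t θ) {t : ℕ} (ht : t ≤ T) :
    expect (run φ M ν W η α N t)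
      (fun o => ∑ k ∈ Finset.range t, G k (o.1 k) + F (o.1 t)) ≤ F 0 := by
  induction t with
  | zero => simp [run, expect_pure]
  | succ t ih =>
    have hs := hasExpect_run_potential M ν hW hη α hN (G := G) (F := F) (t := t + 1) hb
      (fun k hk => hG k (hk.trans_le ht)) hF (φ := φ)
    have hs0 := hasExpect_run_potential M ν hW hη α hN (G := G) (F := F) (t := t) hb
      (fun k hk => hG k (by omega)) hF (φ := φ)
    rw [run] at hs ⊢
    rw [expect_bind hs]
    refine (expect_mono hs.bind hs0 fun o ho => ?_).trans (ih (by omega))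
    set f : (ℕ → EuclideanSpace ℝ (Fin d)) × ℕ → ℝ := fun o =>
      ∑ k ∈ Finset.range (t + 1), G k (o.1 k) + F (o.1 (t + 1)) with hf
    rw [expect_map (f := f) ((hasExpect_map (f := f)).1 (hs.bind_kernel ho))]
    -- The update writes only position `t + 1`, so the terms for earlier iterates are constants
    -- given the past.
    have e : ∀ c : EuclideanSpace ℝ (Fin d) × EuclideanSpace ℝ (Fin d) × ℕ,
        ∑ k ∈ Finset.range (t + 1), G k (Function.update o.1 (t + 1)
          (o.1 t + η • ((1 / (N : ℝ)) • c.2.1)) k) +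
          F (Function.update o.1 (t + 1) (o.1 t + η • ((1 / (N : ℝ)) • c.2.1)) (t + 1)) =
        ∑ k ∈ Finset.range (t + 1), G k (o.1 k) +
          F (o.1 t + η • ((1 / (N : ℝ)) • c.2.1)) := by
      intro c
      rw [Function.update_self]
      congr 1
      refine Finset.sum_congr rfl fun k hk => ?_
      rw [Function.update_of_ne (Finset.mem_range.1 hk).ne]
    simp only [hf, e]
    have hFs : HasExpect (sgd φ M ν W α (o.1 t) N) fun c =>
        F (o.1 t + η • ((1 / (N : ℝ)) • c.2.1)) := by
      refine hasExpect_of_bdd (C := a + b * (‖o.1 t‖ + η * W)) fun c hc => (hF _).trans ?_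
      gcongr
      refine (norm_add_le _ _).trans ?_
      rw [norm_smul, Real.norm_eq_abs, abs_of_nonneg hη]
      gcongr
      exact norm_average_le hN (mem_support_sgd M ν hW α _ hc).2
    rw [expect_add (hasExpect_const _ _) hFs, expect_const, Finset.sum_range_succ]
    linarith [hstep t ht (o.1 t)]

/-- The final potential is nonnegative and can be dropped. All terms are taken under the law of the
full run, as in the bias hypothesis. -/
theorem sum_expect_run_le (M : MDP S A) (ν : PMF (S × A)) {W η : ℝ} (hW : 0 ≤ W)
    (hη : 0 ≤ η) (α : ℝ) {N T : ℕ} (hN : 0 < N) {G : ℕ → EuclideanSpace ℝ (Fin d) → ℝ}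
    {F : EuclideanSpace ℝ (Fin d) → ℝ} {C a b : ℝ} (hb : 0 ≤ b)
    (hG : ∀ k < T, ∀ θ, |G k θ| ≤ C) (hF0 : ∀ θ, 0 ≤ F θ) (hF : ∀ θ, |F θ| ≤ a + b * ‖θ‖)
    (hstep : ∀ t < T, ∀ θ, expect (sgd φ M ν W α θ N)
      (fun c => F (θ + η • ((1 / (N : ℝ)) • c.2.1))) ≤ F θ - G t θ) :
    ∑ t ∈ Finset.range T, expect (run φ M ν W η α N T) (fun o => G t (o.1 t)) ≤ F 0 := by
  have hGs : ∀ t ∈ Finset.range T, HasExpect (run φ M ν W η α N T) fun o => G t (o.1 t) :=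
    fun t ht => hasExpect_of_bdd fun o _ => hG t (Finset.mem_range.1 ht) _
  rw [← expect_sum _ hGs]
  refine (expect_mono (hasExpect_sum _ hGs)
    (hasExpect_run_potential M ν hW hη α hN hb hG hF) fun o _ => ?_).trans
    (expect_run_potential_le M ν hW hη α hN hb hG hF hstep le_rfl)
  exact le_add_of_nonneg_right (hF0 _)

/-- The bound on the best iterate, before the learning rate `η` is chosen. -/
theorem sum_expect_gap_le (hφ : ∀ s a, ‖φ s a‖ ≤ B) (M : MDP S A) (ρ : PMF S)
    (ν : PMF (S × A)) (π : S → PMF A) {W η α : ℝ} (hW : 0 < W) (hB : 0 < B) (hη : 0 ≤ η)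
    {N T : ℕ} (hN : 0 < N)
    (hα : α = W / (2 * B * (B * W + 1 / (1 - M.γ)) * Real.sqrt N)) {κ : ℝ≥0}
    (hκ : relCond φ (M.dStar π ρ) (fun x => (ν x).toReal) = κ)
    {z : ℕ → EuclideanSpace ℝ (Fin d) → EuclideanSpace ℝ (Fin d)}
    (hz : ∀ t < T, ∀ θ, ‖z t θ‖ ≤ W)
    (hmin : ∀ t < T, ∀ θ v, ‖v‖ ≤ W →
      sqLoss φ M (logLinear φ θ) (M.visitPMF (logLinear φ θ) ν) (z t θ) ≤
      sqLoss φ M (logLinear φ θ) (M.visitPMF (logLinear φ θ) ν) v) {ε : ℝ}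
    (hbias : ∀ t < T, expect (run φ M ν W η α N T) (fun o =>
      sqLoss φ M (logLinear φ (o.1 t)) (joint (M.stateVisitPMF π ρ)
        fun _ => PMF.uniformOfFintype A) (z t (o.1 t))) ≤ ε) :
    η * ∑ t ∈ Finset.range T, expect (run φ M ν W η α N T) (fun o => gap φ M π ρ (o.1 t)) ≤
      (1 - M.γ)⁻¹ * Real.log (Fintype.card A) +
        T * ((1 - M.γ)⁻¹ * (η ^ 2 * (B * W) ^ 2 / 2) +
          η * (2 * (1 - M.γ)⁻¹ * Real.sqrt (Fintype.card A * ε)) +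
          η * (2 * (1 - M.γ)⁻¹ * Real.sqrt (Fintype.card A * (κ * ((1 - M.γ)⁻¹ *
          (2 * (B * W) * (B * W + 1) * (1 - M.γ)⁻¹ / Real.sqrt N)))))) := by
  set R := (1 - M.γ)⁻¹ with hR
  have hR0 : 0 ≤ R := inv_nonneg.2 M.one_sub_pos.le
  set D := M.stateVisitPMF π ρ with hD
  set C' := 2 * R * Real.sqrt (Fintype.card A * (κ * (R *
          (2 * (B * W) * (B * W + 1) * R / Real.sqrt N)))) with hC'
  set P := run φ M ν W η α N T with hP
  set L := R * (η ^ 2 * (B * W) ^ 2 / 2) + η * C' with hL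
  -- The bias term stays inside `G` as a function of `θ`, because the bias is bounded only on
  -- average over the run. Jensen for the square root is applied to it afterwards.
  set G : ℕ → EuclideanSpace ℝ (Fin d) → ℝ := fun t θ =>
    (η * gap φ M π ρ θ - η * (2 * R) * biasTerm φ M π ρ θ (z t θ)) - L with hG
  set F : EuclideanSpace ℝ (Fin d) → ℝ := fun θ => R * crossEntropy φ D π θ with hF
  have hgap : ∀ t, HasExpect P fun o => gap φ M π ρ (o.1 t) := fun t =>
    hasExpect_of_bdd fun o _ => abs_gap_le M π ρ _
  have hbt : ∀ t < T, HasExpect P fun o => biasTerm φ M π ρ (o.1 t) (z t (o.1 t)) := fun t ht =>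
    hasExpect_of_bdd fun o _ => abs_biasTerm_le hφ hB.le M π ρ _ (hz t ht _)
  have h := sum_expect_run_le (φ := φ) M ν hW.le hη α hN (G := G) (F := F) (T := T)
    (C := η * (R + R) + η * (2 * R) * Real.sqrt (Fintype.card A * (R + W * B) ^ 2) + |L|)
    (a := R * Real.log (Fintype.card A)) (b := R * (2 * B)) (by positivity)
    (fun t ht θ => by
      refine (abs_sub _ _).trans (add_le_add ((abs_sub _ _).trans (add_le_add ?_ ?_)) le_rfl)
      · rw [abs_mul, abs_of_nonneg hη]
        exact mul_le_mul_of_nonneg_left (abs_gap_le M π ρ θ) hη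
      · rw [abs_mul, abs_of_nonneg (show 0 ≤ η * (2 * R) by positivity)]
        exact mul_le_mul_of_nonneg_left (abs_biasTerm_le hφ hB.le M π ρ θ (hz t ht θ))
          (by positivity))
    (fun θ => mul_nonneg hR0 (crossEntropy_nonneg D π θ))
    (fun θ => by
      rw [hF, abs_mul, abs_of_nonneg hR0]
      have := mul_le_mul_of_nonneg_left (crossEntropy_le hφ D π θ) hR0
      linarith)
    (fun t ht θ => by
      have := expect_crossEntropy_step hφ M ρ ν π hW hB hη hN hα hκ θ (hz t ht θ) (hmin t ht θ)
      simp only [hF, hG]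
      linarith)
  have hle : ∀ t ∈ Finset.range T, η * expect P (fun o => gap φ M π ρ (o.1 t)) -
      (η * (2 * R) * Real.sqrt (Fintype.card A * ε) + L) ≤ expect P fun o => G t (o.1 t) := by
    intro t ht
    have ht := Finset.mem_range.1 ht
    have h1 := (hgap t).const_mul η
    have h2 := (hbt t ht).const_mul (η * (2 * R))
    simp only [hG]
    rw [expect_sub (h1.sub h2) (hasExpect_const _ _), expect_sub h1 h2, expect_const_mul,
      expect_const_mul, expect_const]
    have hsq : expect P (fun o => biasTerm φ M π ρ (o.1 t) (z t (o.1 t))) ≤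
        Real.sqrt (Fintype.card A * ε) := by
      have hs : HasExpect P fun o => sqLoss φ M (logLinear φ (o.1 t))
          (joint D fun _ => PMF.uniformOfFintype A) (z t (o.1 t)) :=
        hasExpect_of_bdd fun o _ => abs_sqLoss_le hφ hB.le M _ _ (hz t ht _)
      refine (expect_sqrt_le (hs.const_mul _) fun o =>
        mul_nonneg (Nat.cast_nonneg _) (sqLoss_nonneg _ _ _ _ _)).trans (Real.sqrt_le_sqrt ?_)
      rw [expect_const_mul]
      exact mul_le_mul_of_nonneg_left (hbias t ht) (Nat.cast_nonneg _)
    have := mul_le_mul_of_nonneg_left hsq (show 0 ≤ η * (2 * R) by positivity)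
    linarith
  have hsum := (Finset.sum_le_sum hle).trans h
  rw [Finset.sum_sub_distrib, Finset.sum_const, Finset.card_range, nsmul_eq_mul,
    ← Finset.mul_sum] at hsum
  simp only [hF, crossEntropy_zero] at hsum
  rw [hL] at hsum
  linarith

end Run

end QNPG

/-! ### Choice of the learning rate and conclusion. -/

theorem mainTheorem10 {S A : Type*} [Fintype A] [Nonempty A] {d : ℕ}
    (M : QNPG.MDP S A) (φ : S → A → EuclideanSpace ℝ (Fin d))
    (ρ : PMF S) (ν : PMF (S × A)) (πstar : S → PMF A)
    (B W : ℝ) (hB : 0 < B) (hW : 0 < W) (hφ : ∀ s a, ‖φ s a‖ ≤ B)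
    (T N : ℕ) (hT : 0 < T) (hN : 0 < N)
    (η α : ℝ)
    (hη : η = Real.sqrt (2 * Real.log (Fintype.card A) / (B ^ 2 * W ^ 2 * T)))
    (hα : α = W / (2 * B * (B * W + 1 / (1 - M.γ)) * Real.sqrt N))
    (κ : ℝ≥0)
    (hκ : QNPG.relCond φ (M.dStar πstar ρ) (fun x => (ν x).toReal) = κ)
    (wstar : ℕ → EuclideanSpace ℝ (Fin d) → EuclideanSpace ℝ (Fin d))
    (hwstar : ∀ t < T, ∀ θ, wstar t θ ∈ Metric.closedBall 0 W ∧
      IsMinOn (fun w => QNPG.loss φ M w θ (M.visit (QNPG.logLinear φ θ) ν))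
        (Metric.closedBall 0 W) (wstar t θ))
    (εbias : ℝ)
    (hbias : ∀ t < T,
      QNPG.expect (QNPG.run φ M ν W η α N T)
        (fun o => QNPG.loss φ M (wstar t (o.1 t)) (o.1 t) (M.dStar πstar ρ)) ≤ εbias) :
    QNPG.expect (QNPG.run φ M ν W η α N T)
        (fun o => (Finset.range T).inf' (Finset.nonempty_range_iff.mpr hT.ne')
          fun t => M.value πstar ρ - M.value (QNPG.logLinear φ (o.1 t)) ρ)
      ≤ B * W / (1 - M.γ) * Real.sqrt (2 * Real.log (Fintype.card A) / T)
        + Real.sqrt (8 * κ * Fintype.card A * (B * W) * (B * W + 1) / (1 - M.γ) ^ 4)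
            * (1 / (N : ℝ) ^ ((1 : ℝ) / 4))
        + Real.sqrt (4 * Fintype.card A * εbias) / (1 - M.γ)
    ∧ ∑' o, QNPG.run φ M ν W η α N T o * (o.2 : ℝ≥0∞)
      = ENNReal.ofReal (2 * N * T / (1 - M.γ)) := by
  have hγ := M.one_sub_pos
  have hT' : (0 : ℝ) < T := by exact_mod_cast hT
  have hN' : (0 : ℝ) < N := by exact_mod_cast hN
  constructor
  · set P := QNPG.run φ M ν W η α N T with hP
    -- With a single action `log |A| = 0` and hence `η = 0`, so `η` cannot be cancelled; but then
    -- all policies coincide and the gap is 0.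
    rcases subsingleton_or_nontrivial A with hA | hA
    · have hlhs : QNPG.expect P (fun o =>
          (Finset.range T).inf' (Finset.nonempty_range_iff.mpr hT.ne')
          fun t => M.value πstar ρ - M.value (QNPG.logLinear φ (o.1 t)) ρ) = 0 := by
        have e : ∀ θ, QNPG.logLinear φ θ = πstar := by
          intro θ
          have h1 : ∀ (p : PMF A) (a : A), p a = 1 := fun p a => by
            rw [← p.tsum_coe, tsum_eq_single a fun b hb => (hb (Subsingleton.elim b a)).elim]
          funext s
          ext a
          rw [h1, h1]
        simp only [e, sub_self, Finset.inf'_const, QNPG.expect_const]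
      rw [hlhs]
      positivity
    · have hcard : (1 : ℝ) < Fintype.card A := by exact_mod_cast Fintype.one_lt_card
      have hlog : 0 < Real.log (Fintype.card A) := Real.log_pos hcard
      set R := (1 - M.γ)⁻¹ with hR
      have hR0 : 0 < R := inv_pos.2 hγ
      set u := Real.sqrt (2 * Real.log (Fintype.card A) / T) with hu
      have hu0 : 0 < u := Real.sqrt_pos.2 (by positivity)
      have hu2 : u ^ 2 * T = 2 * Real.log (Fintype.card A) := by
        rw [hu, Real.sq_sqrt (by positivity), div_mul_cancel₀ _ hT'.ne']
      have hηu : η * (B * W) = u := by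
        rw [hη, hu]
        have e : 2 * Real.log (Fintype.card A) / (B ^ 2 * W ^ 2 * T) =
            (2 * Real.log (Fintype.card A) / T) / (B * W) ^ 2 := by
          field_simp
        rw [e, Real.sqrt_div' _ (sq_nonneg _), Real.sqrt_sq (by positivity),
          div_mul_cancel₀ _ (by positivity)]
      have hη0 : 0 < η := by
        rw [hη]
        exact Real.sqrt_pos.2 (by positivity)
      have hdS : M.dStar πstar ρ = fun x => (QNPG.joint (M.stateVisitPMF πstar ρ)
          (fun _ => PMF.uniformOfFintype A) x).toReal := funext (M.dStar_eq πstar ρ)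
      have hv : ∀ θ, M.visit (QNPG.logLinear φ θ) ν =
          fun x => (M.visitPMF (QNPG.logLinear φ θ) ν x).toReal :=
        fun θ => funext (M.visit_eq _ ν)
      have hz : ∀ t < T, ∀ θ, ‖wstar t θ‖ ≤ W := fun t ht θ =>
        mem_closedBall_zero_iff.1 (hwstar t ht θ).1
      have h := QNPG.sum_expect_gap_le hφ M ρ ν πstar hW hB hη0.le hN hα hκ hz
        (fun t ht θ v hvW => by
          have := isMinOn_iff.1 (hwstar t ht θ).2 v (mem_closedBall_zero_iff.2 hvW)
          rw [hv] at this
          exact this)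
        (ε := εbias) (by
          rw [hdS] at hbias
          exact hbias)
      rw [← hR, ← hP] at h
      set Cb := 2 * R * Real.sqrt (Fintype.card A * εbias) with hCb
      set Cs := 2 * R * Real.sqrt (Fintype.card A * (κ * (R *
          (2 * (B * W) * (B * W + 1) * R / Real.sqrt N)))) with hCs
      have hgap : ∀ t ∈ Finset.range T,
          QNPG.HasExpect P fun o => QNPG.gap φ M πstar ρ (o.1 t) := fun t _ =>
        QNPG.hasExpect_of_bdd fun o _ => QNPG.abs_gap_le M πstar ρ _
      -- The minimum over the iterates is at most their average.
      have hmin : (T : ℝ) * QNPG.expect P (fun o =>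
          (Finset.range T).inf' (Finset.nonempty_range_iff.mpr hT.ne')
          fun t => M.value πstar ρ - M.value (QNPG.logLinear φ (o.1 t)) ρ) ≤
          ∑ t ∈ Finset.range T, QNPG.expect P (fun o => QNPG.gap φ M πstar ρ (o.1 t)) := by
        rw [← QNPG.expect_const_mul, ← QNPG.expect_sum _ hgap]
        refine QNPG.expect_mono (QNPG.HasExpect.const_mul
          (QNPG.hasExpect_of_bdd (C := R + R) fun o _ => ?_) _)
          (QNPG.hasExpect_sum _ hgap) fun o _ => ?_
        · obtain ⟨t, -, ht⟩ := Finset.exists_mem_eq_inf' (Finset.nonempty_range_iff.mpr hT.ne')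
            fun t => M.value πstar ρ - M.value (QNPG.logLinear φ (o.1 t)) ρ
          rw [ht]
          exact QNPG.abs_gap_le M πstar ρ _
        · have := Finset.card_nsmul_le_sum (Finset.range T)
            (fun t => M.value πstar ρ - M.value (QNPG.logLinear φ (o.1 t)) ρ)
            ((Finset.range T).inf' (Finset.nonempty_range_iff.mpr hT.ne')
              fun t => M.value πstar ρ - M.value (QNPG.logLinear φ (o.1 t)) ρ)
            fun t ht => Finset.inf'_le _ ht
          rw [Finset.card_range, nsmul_eq_mul] at this
          exact this
      have hfin := (mul_le_mul_of_nonneg_left hmin hη0.le).trans h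
      -- The choice `η BW = u` with `T u² = 2 log |A|` makes the initial cross entropy equal to the
      -- accumulated Hoeffding terms. Each contributes half of the first summand of the bound.
      have e0 : R * Real.log (Fintype.card A) + T * (R * (η ^ 2 * (B * W) ^ 2 / 2) +
          η * Cb + η * Cs) = η * (T * (B * W * R * u + Cb + Cs)) := by
        have : η ^ 2 * (B * W) ^ 2 = u ^ 2 := by rw [← hηu]; ring
        rw [this]
        have h2 : η * (T * (B * W * R * u + Cb + Cs)) =
            T * R * u * (η * (B * W)) + T * (η * Cb + η * Cs) := by ring
        rw [h2, hηu]
        linear_combination (-R / 2) * hu2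
      rw [e0] at hfin
      have hfin' := le_of_mul_le_mul_left (le_of_mul_le_mul_left hfin hη0) hT'
      have eb : Real.sqrt (4 * Fintype.card A * εbias) / (1 - M.γ) = Cb := by
        rw [mul_assoc, Real.sqrt_mul (by norm_num), hCb, div_eq_mul_inv, ← hR,
          show (4 : ℝ) = 2 ^ 2 by norm_num, Real.sqrt_sq (by norm_num)]
        ring
      have es : Real.sqrt (8 * κ * Fintype.card A * (B * W) * (B * W + 1) / (1 - M.γ) ^ 4) *
          (1 / (N : ℝ) ^ ((1 : ℝ) / 4)) = Cs := by
        have hq : 1 / (N : ℝ) ^ ((1 : ℝ) / 4) = Real.sqrt (1 / Real.sqrt N) := by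
          rw [Real.sqrt_div zero_le_one, Real.sqrt_one, Real.sqrt_eq_rpow, Real.sqrt_eq_rpow,
            ← Real.rpow_mul hN'.le]
          norm_num
        rw [hq, ← Real.sqrt_mul (by positivity), hCs,
          ← Real.sqrt_sq (show 0 ≤ 2 * R by positivity), ← Real.sqrt_mul (sq_nonneg _)]
        congr 1
        rw [hR]
        field_simp
        ring
      rw [eb, es, div_eq_mul_inv, ← hR]
      linarith
  · have h := QNPG.lexp_run_count (φ := φ) M ν W η α N T
    change QNPG.lexp _ _ = _
    rw [h, ← ENNReal.ofReal_natCast, ← ENNReal.ofReal_natCast, ← ENNReal.ofReal_mul hN'.le,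
      ← ENNReal.ofReal_mul hT'.le]
    congr 1
    rw [div_eq_mul_inv]
    ring
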